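/- Fix integers $K\ge 2$ and $N$ and a storage system with $K$ messages $W_1,\dots,W_K$ and $N$ non-colluding databases given by a fully-connected graph: every database stores exactly two messages, and every two distinct messages are stored together in exactly one database (so $N=\binom K2$, and each message is stored in $K-1$ databases). Let $\mathbb F_q$ be any finite field; entropies and mutual informations are in $q$-ary units. A private information retrieval scheme with message length $L\ge 1$ consists of messages $W_1,\dots,W_K$, independent and uniformly distributed on $\mathbb F_q^L$, and, for every desired message index $k$ and every database $n$, a query $Q_n^{[k]}$ and an answer $A_n^{[k]}$ (random variables with finite alphabets) such that, with $Z_n$ denoting the two messages stored in database $n$: 1. the queries are independent of the messages: $I(W_{1:K};Q_{1:N}^{[k]})=0$ for all $k$; 2. answers are determined by the query and the contents of the database: $H(A_n^{[k]}\mid Q_n^{[k]},Z_n)=0$ for all $k,n$; 3. privacy: for every database $n$, the joint law of $(Q_n^{[k]},A_n^{[k]},W_{1:K})$ does not depend on $k$; 4. reliability: $H(W_k\mid Q_{1:N}^{[k]},A_{1:N}^{[k]})=0$ for all $k$. Its retrieval rate is $L/\sum_{n=1}^N H(A_n^{[k]})$ (the same for all $k$, by privacy), and the PIR capacity $C_{\mathrm{PIR}}$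 is the supremum of the retrieval rates of all schemes over $\mathbb F_q$, over all message lengths $L\ge 1$. Then $$C_{\mathrm{PIR}}=\begin{cases}\tfrac12, & K=2,3,\\[2pt] \tfrac2K, & K\ge 4.\end{cases}$$ -/

import Mathlib

open MeasureTheory ProbabilityTheory

noncomputable section

namespace PIR

/-! Shannon entropies, in `q`-ary units, of random variables with finite alphabets. -/

/-- The entropy `H(X) = - ∑ x, P(X = x) log_q P(X = x)`. -/
def entropy (q : ℕ) {Ω : Type*} [MeasurableSpace Ω] (μ : Measure Ω)
    {α : Type*} [Fintype α] (X : Ω → α) : ℝ :=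
  -∑ x, μ.real (X ⁻¹' {x}) * Real.logb q (μ.real (X ⁻¹' {x}))

/-- The conditional entropy `H(X | Y) = ∑ y, P(Y = y) H(X | Y = y)`. -/
def condEntropy (q : ℕ) {Ω : Type*} [MeasurableSpace Ω] (μ : Measure Ω)
    {α β : Type*} [Fintype α] [Fintype β] (X : Ω → α) (Y : Ω → β) : ℝ :=
  ∑ y, μ.real (Y ⁻¹' {y}) * entropy q (μ[|Y ⁻¹' {y}]) X

/-- The mutual information `I(X; Y) = H(X) - H(X | Y)`. -/
def mutualInfo (q : ℕ) {Ω : Type*} [MeasurableSpace Ω] (μ : Measure Ω)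
    {α β : Type*} [Fintype α] [Fintype β] (X : Ω → α) (Y : Ω → β) : ℝ :=
  entropy q μ X - condEntropy q μ X Y

/-- A storage system with `K` messages and `N` databases: `contents n` is the set of (indices of)
the messages stored in database `n`. -/
structure StorageSystem (K N : ℕ) where
  contents : Fin N → Finset (Fin K)

/-- The storage system is given by a fully-connected graph, with the messages as vertices and the
databases as edges: every database stores two messages, and every two distinct messages are joined
by exactly one database. -/
def StorageSystem.IsFullyConnected {K N : ℕ} (S : StorageSystem K N) : Prop :=
  (∀ n, (S.contents n).card = 2) ∧
    ∀ i j : Fin K, i ≠ j → ∃! n, S.contents n = {i, j}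

/-- A private information retrieval scheme for the storage system `S` and for messages in `F ^ L`,
with `F` a finite field. `W k` is the `k`-th message; `Q k n` and `A k n` are the query to and the
answer of database `n` when message `k` is desired. Entropies are in units of `F`-symbols. -/
structure Scheme {K N : ℕ} (S : StorageSystem K N) (F : Type) [Field F] [Fintype F] (L : ℕ) where
  /-- the underlying probability space -/
  Ω : Type
  [measurableSpace : MeasurableSpace Ω]
  μ : Measure Ω
  [isProbabilityMeasure : IsProbabilityMeasure μ]
  /-- the finite alphabets of the queries and of the answers -/
  Query : Fin N → Type
  [fintypeQuery : ∀ n, Fintype (Query n)]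
  Answer : Fin N → Type
  [fintypeAnswer : ∀ n, Fintype (Answer n)]
  W : Fin K → Ω → Fin L → F
  Q : Fin K → (n : Fin N) → Ω → Query n
  A : Fin K → (n : Fin N) → Ω → Answer n
  measurable_W : ∀ k w, MeasurableSet (W k ⁻¹' {w})
  measurable_Q : ∀ k n x, MeasurableSet (Q k n ⁻¹' {x})
  measurable_A : ∀ k n a, MeasurableSet (A k n ⁻¹' {a})
  /-- the messages are independent and uniformly distributed on `F ^ L` -/
  uniform : ∀ w : Fin K → Fin L → F,
    μ.real {ω | ∀ k, W k ω = w k} = ((Fintype.card F : ℝ) ^ (K * L))⁻¹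
  /-- the queries are independent of the messages -/
  independence : ∀ k,
    mutualInfo (Fintype.card F) μ (fun ω i => W i ω) (fun ω n => Q k n ω) = 0
  /-- an answer is determined by the query and by the contents of the database -/
  answer_deterministic : ∀ k n,
    condEntropy (Fintype.card F) μ (A k n)
      (fun ω => (Q k n ω, fun i : {i // i ∈ S.contents n} => W i ω)) = 0
  /-- privacy: the joint law of query, answer and all messages, at any single database, does not
  depend on the desired message -/
  privacy : ∀ n i j x a (w : Fin K → Fin L → F),
    μ.real {ω | Q i n ω = x ∧ A i n ω = a ∧ ∀ k, W k ω = w k} =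
      μ.real {ω | Q j n ω = x ∧ A j n ω = a ∧ ∀ k, W k ω = w k}
  /-- reliability: the desired message is recovered from all the queries and answers -/
  reliability : ∀ k,
    condEntropy (Fintype.card F) μ (W k)
      (fun ω => ((fun n => Q k n ω : ∀ n, Query n), (fun n => A k n ω : ∀ n, Answer n))) = 0

attribute [instance] Scheme.measurableSpace Scheme.isProbabilityMeasure Scheme.fintypeQuery
  Scheme.fintypeAnswer

/-- The retrieval rate `L / ∑ n, H(A k n)`. By privacy it is the same for all `k`. -/
def Scheme.rate {K N : ℕ} {S : StorageSystem K N} {F : Type} [Field F] [Fintype F] {L : ℕ}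
    (P : Scheme S F L) (k : Fin K) : ℝ :=
  (L : ℝ) / ∑ n, entropy (Fintype.card F) P.μ (P.A k n)

/-- The retrieval rates of all schemes over `F`, for all message lengths `L ≥ 1`. -/
def achievableRates {K N : ℕ} (S : StorageSystem K N) (F : Type) [Field F] [Fintype F] : Set ℝ :=
  {r | ∃ (L : ℕ) (_ : 0 < L) (P : Scheme S F L) (k : Fin K), r = P.rate k}

/-- `c` is the PIR capacity of `S` over `F`: the supremum of the achievable retrieval rates. -/
def IsCapacity {K N : ℕ} (S : StorageSystem K N) (F : Type) [Field F] [Fintype F] (c : ℝ) : Prop :=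
  IsLUB (achievableRates S F) c

end PIR

end

set_option linter.unusedSectionVars false

/-! Converse. Let `leakage j n i` be H(A_n | Q_n, all messages but W_i). By privacy it does not
depend on the desired message j, so reliability for each message in turn gives `le_sum_leakage`: the
leakages of any one message sum to at least L. A database leaks nothing about messages it does not
store, and at most H(A_n) about either of the two it does. Summing over all messages gives K L ≤ 2
D, with D the total download, hence rate at most 2/K.

For K = 2, 3 this is not sharp. There D ≥ L + H(A | Q, W_k) (`add_interference_le_download`), and
the interference term is itself at least L. For K = 2 the single database must leak all of the other
message. For K = 3, with i, i' undesired, chaining the answers of {i, k} and {i, i'}, or of {i', k}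
and {i, i'}, bounds the interference below by two sums of leakages (`leakage_add_leakage_le`), which
together contain all leakages of i and i'.

Achievability. Cut each message into K - 1 symbols, as many as there are databases storing it. Every
database combines one symbol from each of its two messages; for an undesired message the position is
the same everywhere, while each position of the desired message is read at some database. Random
shifts hide which message is desired. Decoding then needs only the K - 1 fixed undesired symbols
(`exists_scheme`). For K ≤ 3 one database returns both its symbols, and the rest follow by
propagation. For K ≥ 4 three undesired messages form a triangle, whose answers u + T v determine its
symbols when T and 1 + T are injective, so no database has to send more than one symbol. -/

namespace PIR

/-! ### Shannon entropy: monotonicity, submodularity, chain rule. -/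

section Entropy

variable {Ω : Type*} [MeasurableSpace Ω] {α β γ : Type*}

/-- A random variable all of whose level sets are measurable. -/
def LevelMeasurable (X : Ω → α) : Prop := ∀ x, MeasurableSet (X ⁻¹' {x})

theorem LevelMeasurable.preimage [Finite α] {X : Ω → α} (hX : LevelMeasurable X) (s : Set α) :
    MeasurableSet (X ⁻¹' s) := by
  have : X ⁻¹' s = ⋃ x ∈ s, X ⁻¹' {x} := by ext; simp
  rw [this]
  exact MeasurableSet.biUnion s.to_countable fun x _ => hX x

theorem LevelMeasurable.comp [Finite α] {X : Ω → α} (hX : LevelMeasurable X) (f : α → β) :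
    LevelMeasurable (fun ω => f (X ω)) := fun y => hX.preimage (f ⁻¹' {y})

theorem LevelMeasurable.prodMk {X : Ω → α} {Y : Ω → β} (hX : LevelMeasurable X)
    (hY : LevelMeasurable Y) : LevelMeasurable (fun ω => (X ω, Y ω)) := by
  rintro ⟨x, y⟩
  have : (fun ω => (X ω, Y ω)) ⁻¹' {(x, y)} = X ⁻¹' {x} ∩ Y ⁻¹' {y} := by ext; simp
  rw [this]
  exact (hX x).inter (hY y)

theorem LevelMeasurable.pi {ι : Type*} [Countable ι] {δ : ι → Type*} {X : ∀ i, Ω → δ i}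
    (hX : ∀ i, LevelMeasurable (X i)) : LevelMeasurable (fun ω i => X i ω) := by
  intro x
  have : (fun ω i => X i ω) ⁻¹' {x} = ⋂ i, X i ⁻¹' {x i} := by
    ext; simp [funext_iff]
  rw [this]
  exact MeasurableSet.iInter fun i => hX i (x i)

variable [Fintype α] [Fintype β] [Fintype γ] (q : ℕ) (μ : Measure Ω) [IsProbabilityMeasure μ]

theorem real_preimage_eq_sum {X : Ω → α} (hX : LevelMeasurable X) (s : Set α)
    [DecidablePred (· ∈ s)] :
    μ.real (X ⁻¹' s) = ∑ x with x ∈ s, μ.real (X ⁻¹' {x}) := by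
  have : X ⁻¹' s = ⋃ x ∈ Finset.univ.filter (· ∈ s), X ⁻¹' {x} := by ext; simp
  rw [this, measureReal_biUnion_finset]
  · intro x _ y _ hxy
    refine Set.disjoint_left.2 fun ω h1 h2 => hxy ?_
    simp only [Set.mem_preimage, Set.mem_singleton_iff] at h1 h2
    exact h1.symm.trans h2
  · exact fun x _ => hX x

theorem sum_real_preimage {X : Ω → α} (hX : LevelMeasurable X) :
    ∑ x, μ.real (X ⁻¹' {x}) = 1 := by
  classical
  have := real_preimage_eq_sum μ hX Set.univ
  simpa using this.symm

open Classical in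
theorem real_preimage_comp {X : Ω → α} (hX : LevelMeasurable X) (f : α → β) (y : β) :
    μ.real ((fun ω => f (X ω)) ⁻¹' {y}) = ∑ x with f x = y, μ.real (X ⁻¹' {x}) := by
  have := real_preimage_eq_sum μ hX (f ⁻¹' {y})
  simpa [Set.preimage_preimage] using this

/-- The entropy of a function of `X`, as an expectation over the values of `X`. -/
theorem entropy_comp {X : Ω → α} (hX : LevelMeasurable X) (f : α → β) :
    entropy q μ (fun ω => f (X ω)) = -∑ x, μ.real (X ⁻¹' {x}) *
      Real.logb q (μ.real ((fun ω => f (X ω)) ⁻¹' {f x})) := by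
  classical
  unfold entropy
  rw [← Finset.sum_fiberwise (s := Finset.univ) (g := f)]
  congr 1
  refine Finset.sum_congr rfl fun y _ => ?_
  conv_lhs => rw [real_preimage_comp μ hX f y, Finset.sum_mul]
  refine Finset.sum_congr rfl fun x hx => ?_
  rw [Finset.mem_filter] at hx
  rw [hx.2, ← real_preimage_comp μ hX f y]

theorem sum_real_preimage_prodMk {X : Ω → α} {Y : Ω → β} (hX : LevelMeasurable X)
    (hY : LevelMeasurable Y) (y : β) :
    ∑ x, μ.real ((fun ω => (X ω, Y ω)) ⁻¹' {(x, y)}) = μ.real (Y ⁻¹' {y}) := by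
  classical
  have h : Y ⁻¹' {y} = ⋃ x ∈ (Finset.univ : Finset α), (fun ω => (X ω, Y ω)) ⁻¹' {(x, y)} := by
    ext; simp
  rw [h, measureReal_biUnion_finset]
  · intro a _ b _ hab
    refine Set.disjoint_left.2 fun ω h1 h2 => hab ?_
    simp only [Set.mem_preimage, Set.mem_singleton_iff, Prod.mk.injEq] at h1 h2
    exact h1.1.symm.trans h2.1
  · exact fun x _ => hX.prodMk hY _

theorem real_preimage_le_comp (X : Ω → α) (f : α → β) (x : α) :
    μ.real (X ⁻¹' {x}) ≤ μ.real ((fun ω => f (X ω)) ⁻¹' {f x}) :=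
  measureReal_mono (fun ω h => by simp only [Set.mem_preimage, Set.mem_singleton_iff] at h ⊢; rw [h])

variable {q}

theorem entropy_comp_le (hq : 1 < q) {X : Ω → α} (hX : LevelMeasurable X) (f : α → β) :
    entropy q μ (fun ω => f (X ω)) ≤ entropy q μ X := by
  rw [entropy_comp q μ hX f, entropy, neg_le_neg_iff]
  refine Finset.sum_le_sum fun x _ => ?_
  rcases (measureReal_nonneg (μ := μ) (s := X ⁻¹' {x})).eq_or_lt with h | h
  · simp [← h]
  · refine mul_le_mul_of_nonneg_left ?_ h.le
    exact Real.logb_le_logb_of_le (by exact_mod_cast hq) h (real_preimage_le_comp μ X f x)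

/-- Entropy is monotone: if `Y` determines `X`, then `H(X) ≤ H(Y)`. -/
theorem entropy_le_of_determines (hq : 1 < q) {X : Ω → α} {Y : Ω → β} (hY : LevelMeasurable Y)
    (h : ∀ ω ω', Y ω = Y ω' → X ω = X ω') : entropy q μ X ≤ entropy q μ Y := by
  obtain ⟨ω₀⟩ := nonempty_of_isProbabilityMeasure μ
  have : ∃ f : β → α, X = fun ω => f (Y ω) := by
    classical
    refine ⟨fun y => if hy : ∃ ω, Y ω = y then X hy.choose else X ω₀, funext fun ω => ?_⟩
    have hy : ∃ ω', Y ω' = Y ω := ⟨ω, rfl⟩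
    simp only [hy, dif_pos]
    exact h _ _ hy.choose_spec.symm
  obtain ⟨f, rfl⟩ := this
  exact entropy_comp_le μ hq hY f

theorem entropy_congr (hq : 1 < q) {X : Ω → α} {Y : Ω → β} (hX : LevelMeasurable X)
    (hY : LevelMeasurable Y) (h : ∀ ω ω', X ω = X ω' ↔ Y ω = Y ω') :
    entropy q μ X = entropy q μ Y :=
  le_antisymm (entropy_le_of_determines μ hq hY fun _ _ => (h _ _).2)
    (entropy_le_of_determines μ hq hX fun _ _ => (h _ _).1)

theorem entropy_nonneg (hq : 1 < q) (X : Ω → α) : 0 ≤ entropy q μ X := by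
  rw [entropy, ← Finset.sum_neg_distrib]
  refine Finset.sum_nonneg fun x _ => ?_
  rw [← mul_neg]
  refine mul_nonneg measureReal_nonneg (neg_nonneg.2 ?_)
  exact Real.logb_nonpos (by exact_mod_cast hq) measureReal_nonneg measureReal_le_one

/-- Submodularity of entropy. -/
theorem entropy_submodular (hq : 1 < q) {X : Ω → α} {Y : Ω → β} {Z : Ω → γ}
    (hX : LevelMeasurable X) (hY : LevelMeasurable Y) (hZ : LevelMeasurable Z) :
    entropy q μ (fun ω => (X ω, Y ω, Z ω)) + entropy q μ Z ≤
      entropy q μ (fun ω => (X ω, Z ω)) + entropy q μ (fun ω => (Y ω, Z ω)) := by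
  classical
  set V : Ω → α × β × γ := fun ω => (X ω, Y ω, Z ω) with hV
  have hVm : LevelMeasurable V := hX.prodMk (hY.prodMk hZ)
  have e0 := entropy_comp q μ hVm id
  have e1 := entropy_comp q μ hVm (fun v => v.2.2)
  have e2 := entropy_comp q μ hVm (fun v => (v.1, v.2.2))
  have e3 := entropy_comp q μ hVm (fun v => (v.2.1, v.2.2))
  simp only [id, hV] at e0 e1 e2 e3
  rw [e0, e1, e2, e3]
  set p : α × β × γ → ℝ := fun v => μ.real (V ⁻¹' {v})
  set pz : γ → ℝ := fun z => μ.real (Z ⁻¹' {z})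
  set px : α × γ → ℝ := fun z => μ.real ((fun ω => (X ω, Z ω)) ⁻¹' {z})
  set py : β × γ → ℝ := fun z => μ.real ((fun ω => (Y ω, Z ω)) ⁻¹' {z})
  change -∑ v, p v * Real.logb q (p v) + -∑ v, p v * Real.logb q (pz v.2.2) ≤
    -∑ v, p v * Real.logb q (px (v.1, v.2.2)) + -∑ v, p v * Real.logb q (py (v.2.1, v.2.2))
  have hlq : 0 < Real.log q := Real.log_pos (by exact_mod_cast hq)
  -- The bound log x ≤ x - 1 at x = px py / (p pz); summed over all values, the right-hand sides
  -- cancel to 0.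
  have key : ∀ v, p v * (Real.logb q (px (v.1, v.2.2)) + Real.logb q (py (v.2.1, v.2.2))
      - Real.logb q (p v) - Real.logb q (pz v.2.2)) ≤
      (px (v.1, v.2.2) * py (v.2.1, v.2.2) / pz v.2.2 - p v) / Real.log q := by
    intro v
    have hp0 : 0 ≤ p v := measureReal_nonneg
    have hpx : p v ≤ px (v.1, v.2.2) := real_preimage_le_comp μ V (fun v => (v.1, v.2.2)) v
    have hpy : p v ≤ py (v.2.1, v.2.2) := real_preimage_le_comp μ V (fun v => (v.2.1, v.2.2)) v
    have hpz : p v ≤ pz v.2.2 := real_preimage_le_comp μ V (fun v => v.2.2) v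
    rcases hp0.eq_or_lt with h | h
    · rw [← h] at hpx hpy hpz ⊢
      simp only [zero_mul, sub_zero]
      positivity
    · have hx := h.trans_le hpx
      have hy := h.trans_le hpy
      have hz := h.trans_le hpz
      have hlog := Real.log_le_sub_one_of_pos
        (x := px (v.1, v.2.2) * py (v.2.1, v.2.2) / (p v * pz v.2.2)) (by positivity)
      rw [Real.log_div (by positivity) (by positivity), Real.log_mul hx.ne' hy.ne',
        Real.log_mul h.ne' hz.ne'] at hlog
      simp only [Real.logb]
      rw [← add_div, ← sub_div, ← sub_div, ← mul_div_assoc]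
      refine div_le_div_of_nonneg_right ?_ hlq.le
      have h2 := mul_le_mul_of_nonneg_left hlog h.le
      have h3 : p v * (px (v.1, v.2.2) * py (v.2.1, v.2.2) / (p v * pz v.2.2) - 1)
        = px (v.1, v.2.2) * py (v.2.1, v.2.2) / pz v.2.2 - p v := by field_simp
      rw [h3] at h2
      linarith
  have hsum := Finset.sum_le_sum fun v (_ : v ∈ Finset.univ) => key v
  have hp1 : ∑ v, p v = 1 := sum_real_preimage μ hVm
  have hmx : ∀ z, ∑ x, px (x, z) = pz z := fun z => sum_real_preimage_prodMk μ hX hZ z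
  have hmy : ∀ z, ∑ x, py (x, z) = pz z := fun z => sum_real_preimage_prodMk μ hY hZ z
  have hbound : ∑ v : α × β × γ, px (v.1, v.2.2) * py (v.2.1, v.2.2) / pz v.2.2 = 1 := by
    have : ∑ v : α × β × γ, px (v.1, v.2.2) * py (v.2.1, v.2.2) / pz v.2.2
      = ∑ z, (∑ x, px (x, z)) * (∑ y, py (y, z)) / pz z := by
      simp only [Fintype.sum_prod_type]
      conv_lhs => enter [2, x]; rw [Finset.sum_comm]
      rw [Finset.sum_comm]
      refine Finset.sum_congr rfl fun z _ => ?_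
      rw [Finset.sum_mul_sum, Finset.sum_div]
      refine Finset.sum_congr rfl fun z _ => ?_
      rw [Finset.sum_div]
    rw [this, ← sum_real_preimage μ hZ]
    refine Finset.sum_congr rfl fun z _ => ?_
    -- Values z of probability zero are covered too, since 0 * 0 / 0 = 0.
    rw [hmx, hmy, mul_self_div_self]
  rw [← Finset.sum_div, Finset.sum_sub_distrib, hp1, hbound] at hsum
  simp only [mul_sub, mul_add, Finset.sum_sub_distrib, Finset.sum_add_distrib] at hsum
  simp only [sub_self, zero_div] at hsum
  linarith

/-- The chain rule. -/
theorem condEntropy_eq {X : Ω → α} {Y : Ω → β} (hX : LevelMeasurable X) (hY : LevelMeasurable Y) :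
    condEntropy q μ X Y = entropy q μ (fun ω => (X ω, Y ω)) - entropy q μ Y := by
  have e1 := entropy_comp q μ (hX.prodMk hY) Prod.snd
  simp only at e1
  rw [e1, entropy, sub_neg_eq_add, neg_add_eq_sub, ← Finset.sum_sub_distrib,
    Fintype.sum_prod_type_right, condEntropy]
  refine Finset.sum_congr rfl fun y _ => ?_
  rw [entropy, mul_neg, Finset.mul_sum, ← Finset.sum_neg_distrib]
  refine Finset.sum_congr rfl fun x _ => ?_
  have hinter : (fun ω => (X ω, Y ω)) ⁻¹' {(x, y)} = Y ⁻¹' {y} ∩ X ⁻¹' {x} := by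
    ext; simp [and_comm]
  have hle : μ.real (Y ⁻¹' {y} ∩ X ⁻¹' {x}) ≤ μ.real (Y ⁻¹' {y}) :=
    measureReal_mono Set.inter_subset_left
  have h0 : 0 ≤ μ.real (Y ⁻¹' {y} ∩ X ⁻¹' {x}) := measureReal_nonneg
  rw [hinter, measureReal_def (μ := μ[|Y ⁻¹' {y}]), cond_apply (hY y), ENNReal.toReal_mul,
    ENNReal.toReal_inv, ← measureReal_def, ← measureReal_def]
  set a := μ.real (Y ⁻¹' {y} ∩ X ⁻¹' {x})
  set b := μ.real (Y ⁻¹' {y})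
  rcases h0.eq_or_lt with h | h
  · simp [← h]
  · have hb := h.trans_le hle
    rw [Real.logb_mul (by positivity) h.ne', Real.logb_inv]
    field_simp
    ring

/-- The entropy is at most the logarithm of the size of the alphabet. -/
theorem entropy_le_logb_card (hq : 1 < q) {X : Ω → α} (hX : LevelMeasurable X) :
    entropy q μ X ≤ Real.logb q (Fintype.card α) := by
  obtain ⟨ω₀⟩ := nonempty_of_isProbabilityMeasure μ
  have : Nonempty α := ⟨X ω₀⟩
  have hn : (0 : ℝ) < Fintype.card α := by exact_mod_cast Fintype.card_pos
  have hlq : 0 < Real.log q := Real.log_pos (by exact_mod_cast hq)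
  -- Gibbs' inequality against the uniform law: log x ≤ x - 1 at x = 1 / (p |α|).
  have key : ∀ x, -(μ.real (X ⁻¹' {x}) * Real.logb q (μ.real (X ⁻¹' {x})))
      ≤ μ.real (X ⁻¹' {x}) * Real.logb q (Fintype.card α) +
        ((Fintype.card α : ℝ)⁻¹ - μ.real (X ⁻¹' {x})) / Real.log q := by
    intro x
    have h0 : 0 ≤ μ.real (X ⁻¹' {x}) := measureReal_nonneg
    set p := μ.real (X ⁻¹' {x})
    rcases h0.eq_or_lt with h | h
    · rw [← h]; simp; positivity
    · have hlog := Real.log_le_sub_one_of_pos (x := (p * Fintype.card α)⁻¹) (by positivity)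
      rw [Real.log_inv, Real.log_mul h.ne' hn.ne'] at hlog
      have h2 := mul_le_mul_of_nonneg_left hlog h.le
      have h3 : p * ((p * Fintype.card α)⁻¹ - 1) = (Fintype.card α : ℝ)⁻¹ - p := by field_simp
      rw [h3] at h2
      simp only [Real.logb]
      rw [← mul_div_assoc, ← mul_div_assoc, ← add_div, ← neg_div]
      refine div_le_div_of_nonneg_right ?_ hlq.le
      linarith
  have hsum := Finset.sum_le_sum fun v (_ : v ∈ Finset.univ) => key v
  rw [Finset.sum_add_distrib, ← Finset.sum_div, Finset.sum_sub_distrib, ← Finset.sum_mul,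
    sum_real_preimage μ hX] at hsum
  simp only [Finset.sum_neg_distrib, one_mul, Finset.sum_const, Finset.card_univ, nsmul_eq_mul,
    mul_inv_cancel₀ hn.ne', sub_self, zero_div, add_zero] at hsum
  exact hsum

theorem entropy_comp_eq_of_law {δ : Type*} [Fintype δ] {X Y : Ω → α} (hX : LevelMeasurable X)
    (hY : LevelMeasurable Y) (h : ∀ x, μ.real (X ⁻¹' {x}) = μ.real (Y ⁻¹' {x})) (f : α → δ) :
    entropy q μ (fun ω => f (X ω)) = entropy q μ (fun ω => f (Y ω)) := by
  classical
  simp only [entropy, real_preimage_comp μ hX, real_preimage_comp μ hY, h]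

/-- The entropy of a uniformly distributed random variable. -/
theorem entropy_of_uniform {X : Ω → α} (h : ∀ x, μ.real (X ⁻¹' {x}) = (Fintype.card α : ℝ)⁻¹) :
    entropy q μ X = Real.logb q (Fintype.card α) := by
  obtain ⟨ω₀⟩ := nonempty_of_isProbabilityMeasure μ
  have : Nonempty α := ⟨X ω₀⟩
  have hn : (Fintype.card α : ℝ) ≠ 0 := by exact_mod_cast Fintype.card_ne_zero
  simp [entropy, h, Real.logb_inv, hn]

/-- The entropy of an independent pair is the sum of the entropies. -/
theorem entropy_prodMk_of_indep {X : Ω → α} {Y : Ω → β} (hX : LevelMeasurable X)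
    (hY : LevelMeasurable Y)
    (h : ∀ x y, μ.real (X ⁻¹' {x} ∩ Y ⁻¹' {y}) = μ.real (X ⁻¹' {x}) * μ.real (Y ⁻¹' {y})) :
    entropy q μ (fun ω => (X ω, Y ω)) = entropy q μ X + entropy q μ Y := by
  have hinter : ∀ x y, (fun ω => (X ω, Y ω)) ⁻¹' {(x, y)} = X ⁻¹' {x} ∩ Y ⁻¹' {y} := by
    intro x y; ext; simp
  have key : ∀ x y, μ.real (X ⁻¹' {x} ∩ Y ⁻¹' {y}) *
      Real.logb q (μ.real (X ⁻¹' {x} ∩ Y ⁻¹' {y})) =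
      μ.real (X ⁻¹' {x}) * Real.logb q (μ.real (X ⁻¹' {x})) * μ.real (Y ⁻¹' {y}) +
      μ.real (X ⁻¹' {x}) * (μ.real (Y ⁻¹' {y}) * Real.logb q (μ.real (Y ⁻¹' {y}))) := by
    intro x y
    rw [h]
    by_cases hx : μ.real (X ⁻¹' {x}) = 0
    · simp [hx]
    by_cases hy : μ.real (Y ⁻¹' {y}) = 0
    · simp [hy]
    rw [Real.logb_mul hx hy]
    ring
  simp only [entropy, Fintype.sum_prod_type, hinter, key, Finset.sum_add_distrib,
    ← Finset.mul_sum, sum_real_preimage μ hY, mul_one, ← Finset.sum_mul, sum_real_preimage μ hX]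
  ring

end Entropy

/-! ### Inequalities for conditional entropy and independence. -/

section CondEntropy

variable {Ω : Type*} [MeasurableSpace Ω] {α β γ δ : Type*}
  [Fintype α] [Fintype β] [Fintype γ] [Fintype δ] {q : ℕ} {μ : Measure Ω} [IsProbabilityMeasure μ]

theorem condEntropy_nonneg (hq : 1 < q) {X : Ω → α} {Y : Ω → β} (hX : LevelMeasurable X)
    (hY : LevelMeasurable Y) : 0 ≤ condEntropy q μ X Y := by
  rw [condEntropy_eq μ hX hY, sub_nonneg]
  exact entropy_le_of_determines μ hq (hX.prodMk hY) (by simp +contextual)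

theorem condEntropy_mono_left (hq : 1 < q) {X : Ω → α} {X' : Ω → γ} {Y : Ω → β}
    (hX : LevelMeasurable X) (hX' : LevelMeasurable X') (hY : LevelMeasurable Y)
    (h : ∀ ω ω', X' ω = X' ω' → X ω = X ω') : condEntropy q μ X Y ≤ condEntropy q μ X' Y := by
  rw [condEntropy_eq μ hX hY, condEntropy_eq μ hX' hY]
  refine sub_le_sub_right (entropy_le_of_determines μ hq (hX'.prodMk hY) fun ω ω' hω => ?_) _
  simp only [Prod.mk.injEq] at hω ⊢
  exact ⟨h _ _ hω.1, hω.2⟩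

/-- Conditioning on more reduces the entropy. -/
theorem condEntropy_anti_right (hq : 1 < q) {X : Ω → α} {Y : Ω → β} {Y' : Ω → γ}
    (hX : LevelMeasurable X) (hY : LevelMeasurable Y) (hY' : LevelMeasurable Y')
    (h : ∀ ω ω', Y ω = Y ω' → Y' ω = Y' ω') : condEntropy q μ X Y ≤ condEntropy q μ X Y' := by
  rw [condEntropy_eq μ hX hY, condEntropy_eq μ hX hY']
  have h1 := entropy_submodular μ hq hX hY hY'
  have h2 : entropy q μ (fun ω => (Y ω, Y' ω)) ≤ entropy q μ Y :=
    entropy_le_of_determines μ hq hY fun ω ω' hω => by simp [hω, h _ _ hω]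
  have h3 : entropy q μ (fun ω => (X ω, Y ω)) ≤ entropy q μ (fun ω => (X ω, Y ω, Y' ω)) :=
    entropy_le_of_determines μ hq (hX.prodMk (hY.prodMk hY')) (by simp +contextual)
  linarith

theorem entropy_prodMk_le (hq : 1 < q) {X : Ω → α} {Y : Ω → β} (hX : LevelMeasurable X)
    (hY : LevelMeasurable Y) :
    entropy q μ (fun ω => (X ω, Y ω)) ≤ entropy q μ X + entropy q μ Y := by
  have hu : LevelMeasurable (fun _ : Ω => ()) := fun _ => MeasurableSet.const _
  have h1 := entropy_submodular μ hq hX hY hu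
  have h2 := entropy_nonneg μ hq (fun _ : Ω => ())
  have h3 : entropy q μ (fun ω => (X ω, Y ω)) ≤ entropy q μ (fun ω => (X ω, Y ω, ())) :=
    entropy_le_of_determines μ hq (hX.prodMk (hY.prodMk hu)) (by simp)
  have h4 : entropy q μ (fun ω => (X ω, ())) ≤ entropy q μ X :=
    entropy_le_of_determines μ hq hX (by simp)
  have h5 : entropy q μ (fun ω => (Y ω, ())) ≤ entropy q μ Y :=
    entropy_le_of_determines μ hq hY (by simp)
  linarith

theorem condEntropy_le_entropy (hq : 1 < q) {X : Ω → α} {Y : Ω → β} (hX : LevelMeasurable X)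
    (hY : LevelMeasurable Y) : condEntropy q μ X Y ≤ entropy q μ X := by
  rw [condEntropy_eq μ hX hY]
  linarith [entropy_prodMk_le (μ := μ) hq hX hY]

theorem condEntropy_prodMk (hq : 1 < q) {X : Ω → α} {X' : Ω → γ} {Y : Ω → β}
    (hX : LevelMeasurable X) (hX' : LevelMeasurable X') (hY : LevelMeasurable Y) :
    condEntropy q μ (fun ω => (X ω, X' ω)) Y =
      condEntropy q μ X Y + condEntropy q μ X' (fun ω => (X ω, Y ω)) := by
  rw [condEntropy_eq μ hX hY, condEntropy_eq μ hX' (hX.prodMk hY),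
    condEntropy_eq μ (hX.prodMk hX') hY,
    entropy_congr μ hq ((hX.prodMk hX').prodMk hY) (hX'.prodMk (hX.prodMk hY))]
  · ring
  · intro ω ω'
    simp only [Prod.mk.injEq]
    tauto

theorem condEntropy_pi_le (hq : 1 < q) {ι : Type*} [Fintype ι] [DecidableEq ι] {A : ι → Type*}
    [∀ i, Fintype (A i)] {X : ∀ i, Ω → A i} {Y : Ω → β} (hX : ∀ i, LevelMeasurable (X i))
    (hY : LevelMeasurable Y) :
    condEntropy q μ (fun ω i => X i ω) Y ≤ ∑ i, condEntropy q μ (X i) Y := by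
  have key : ∀ s : Finset ι, condEntropy q μ (fun ω (i : s) => X i ω) Y ≤
      ∑ i ∈ s, condEntropy q μ (X i) Y := by
    intro s
    induction s using Finset.induction_on with
    | empty =>
      have h0 : LevelMeasurable (fun ω (i : (∅ : Finset ι)) => X i ω) :=
        LevelMeasurable.pi fun i => hX i
      rw [condEntropy_eq μ h0 hY, Finset.sum_empty]
      have := entropy_le_of_determines μ hq hY
        (X := fun ω => ((fun i : (∅ : Finset ι) => X i ω), Y ω)) fun ω ω' h => by
          simp only [Prod.mk.injEq, h, and_true]
          funext i
          exact absurd i.2 (Finset.notMem_empty _)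
      linarith
    | insert a s ha ih =>
      rw [Finset.sum_insert ha]
      have hs : LevelMeasurable (fun ω (i : s) => X i ω) := LevelMeasurable.pi fun i => hX i
      have h1 := condEntropy_mono_left (μ := μ) hq
        (LevelMeasurable.pi fun i : ↥(insert a s) => hX i) ((hX a).prodMk hs) hY
        fun ω ω' h => by
          simp only [Prod.mk.injEq, funext_iff] at h
          funext i
          obtain ⟨i, hi⟩ := i
          rcases Finset.mem_insert.1 hi with rfl | hi
          · exact h.1
          · exact h.2 ⟨i, hi⟩
      have h2 := condEntropy_prodMk (μ := μ) hq (hX a) hs hY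
      have h3 := condEntropy_anti_right (μ := μ) hq hs ((hX a).prodMk hY) hY (by simp)
      linarith
  refine le_trans ?_ (key Finset.univ)
  refine condEntropy_mono_left hq (LevelMeasurable.pi hX) (LevelMeasurable.pi fun i => hX i) hY
    fun ω ω' h => ?_
  funext i
  exact congrFun h ⟨i, Finset.mem_univ i⟩

/-- Functions of independent random variables are independent. -/
theorem entropy_add_entropy_le_of_indep (hq : 1 < q) {X : Ω → α} {Y : Ω → β} {X' : Ω → γ}
    {Y' : Ω → δ} (hX : LevelMeasurable X) (hY : LevelMeasurable Y) (hX' : LevelMeasurable X')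
    (hY' : LevelMeasurable Y') (h : entropy q μ (fun ω => (X ω, Y ω)) = entropy q μ X + entropy q μ Y)
    (hXX' : ∀ ω ω', X ω = X ω' → X' ω = X' ω') (hYY' : ∀ ω ω', Y ω = Y ω' → Y' ω = Y' ω') :
    entropy q μ X' + entropy q μ Y' ≤ entropy q μ (fun ω => (X' ω, Y' ω)) := by
  -- Replacing X by X', and then Y by Y', lowers the joint entropy by no more than the marginal one,
  -- so additivity survives both replacements.
  have h1 := condEntropy_anti_right (μ := μ) hq hX (hX'.prodMk hY) hX' (by simp +contextual)
  have h2 := condEntropy_anti_right (μ := μ) hq hY (hX'.prodMk hY') hY' (by simp +contextual)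
  rw [condEntropy_eq μ hX (hX'.prodMk hY), condEntropy_eq μ hX hX'] at h1
  rw [condEntropy_eq μ hY (hX'.prodMk hY'), condEntropy_eq μ hY hY'] at h2
  have h3 : entropy q μ (fun ω => (X ω, X' ω)) ≤ entropy q μ X :=
    entropy_le_of_determines μ hq hX fun ω ω' hω => by simp [hω, hXX' _ _ hω]
  have h4 : entropy q μ (fun ω => (Y ω, Y' ω)) ≤ entropy q μ Y :=
    entropy_le_of_determines μ hq hY fun ω ω' hω => by simp [hω, hYY' _ _ hω]
  have h5 : entropy q μ (fun ω => (X ω, Y ω)) ≤ entropy q μ (fun ω => (X ω, X' ω, Y ω)) :=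
    entropy_le_of_determines μ hq (hX.prodMk (hX'.prodMk hY)) (by simp +contextual)
  have h6 : entropy q μ (fun ω => (X' ω, Y ω)) ≤ entropy q μ (fun ω => (Y ω, X' ω, Y' ω)) :=
    entropy_le_of_determines μ hq (hY.prodMk (hX'.prodMk hY')) (by simp +contextual)
  linarith

end CondEntropy

/-! ### The converse: leakage and interference. -/

namespace Scheme

variable {K N : ℕ} {S : StorageSystem K N} {F : Type} [Field F] [Fintype F] {L : ℕ}
  (P : Scheme S F L)

open Classical in
/-- The messages with index in `s`; the others are replaced by zero. -/
noncomputable def mask (s : Set (Fin K)) (w : Fin K → Fin L → F) : Fin K → Fin L → F :=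
  fun i => if i ∈ s then w i else 0

/-- The messages with index in `s`, as a random variable. -/
noncomputable def maskedMessages (s : Set (Fin K)) (ω : P.Ω) : Fin K → Fin L → F :=
  mask s fun i => P.W i ω

theorem maskedMessages_eq_iff (s : Set (Fin K)) (ω ω' : P.Ω) :
    P.maskedMessages s ω = P.maskedMessages s ω' ↔ ∀ i ∈ s, P.W i ω = P.W i ω' := by
  simp only [maskedMessages, mask, funext_iff (α := Fin K)]
  refine forall_congr' fun i => ?_
  by_cases hi : i ∈ s <;> simp [hi]

/-- All the queries that are sent when message `k` is desired. -/
def queries (k : Fin K) (ω : P.Ω) : ∀ n, P.Query n := fun n => P.Q k n ω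

/-- All the answers that are received when message `k` is desired. -/
def answers (k : Fin K) (ω : P.Ω) : ∀ n, P.Answer n := fun n => P.A k n ω

theorem queries_eq_iff (k : Fin K) (ω ω' : P.Ω) :
    P.queries k ω = P.queries k ω' ↔ ∀ n, P.Q k n ω = P.Q k n ω' := funext_iff

theorem answers_eq_iff (k : Fin K) (ω ω' : P.Ω) :
    P.answers k ω = P.answers k ω' ↔ ∀ n, P.A k n ω = P.A k n ω' := funext_iff

theorem levelMeasurable_queries (k : Fin K) : LevelMeasurable (P.queries k) :=
  LevelMeasurable.pi (P.measurable_Q k)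

theorem levelMeasurable_answers (k : Fin K) : LevelMeasurable (P.answers k) :=
  LevelMeasurable.pi (P.measurable_A k)

theorem levelMeasurable_messages : LevelMeasurable (fun ω i => P.W i ω) :=
  LevelMeasurable.pi P.measurable_W

theorem levelMeasurable_maskedMessages (s : Set (Fin K)) :
    LevelMeasurable (P.maskedMessages s) :=
  P.levelMeasurable_messages.comp (mask s)

omit P in
theorem one_lt_card : 1 < Fintype.card F := Fintype.one_lt_card

theorem entropy_messages :
    entropy (Fintype.card F) P.μ (fun ω i => P.W i ω) = K * L := by
  have hq : (1 : ℝ) < Fintype.card F := by exact_mod_cast one_lt_card (F := F)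
  rw [entropy_of_uniform]
  · simp only [Fintype.card_pi, Finset.prod_const, Finset.card_univ, Fintype.card_fin]
    push_cast
    rw [← pow_mul, Real.logb_pow, Real.logb_self_eq_one hq]
    push_cast
    ring
  · intro w
    have := P.uniform w
    simp only [Fintype.card_pi, Finset.prod_const, Finset.card_univ, Fintype.card_fin]
    push_cast
    rw [← pow_mul, mul_comm L K, ← this]
    congr 1
    ext ω
    simp [funext_iff]

theorem entropy_maskedMessages_le (s : Finset (Fin K)) :
    entropy (Fintype.card F) P.μ (P.maskedMessages s) ≤ s.card * L := by
  have hq : (1 : ℝ) < Fintype.card F := by exact_mod_cast one_lt_card (F := F)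
  have hm : LevelMeasurable (fun ω (i : s) => P.W i ω) :=
    LevelMeasurable.pi fun i => P.measurable_W i
  refine (entropy_le_of_determines P.μ one_lt_card hm fun ω ω' h => ?_).trans
    ((entropy_le_logb_card P.μ one_lt_card hm).trans_eq ?_)
  · rw [maskedMessages_eq_iff]
    exact fun i hi => congrFun h ⟨i, hi⟩
  · simp only [Fintype.card_pi, Finset.prod_const, Finset.card_univ, Fintype.card_fin,
      Fintype.card_coe]
    push_cast
    rw [← pow_mul, Real.logb_pow, Real.logb_self_eq_one hq]
    push_cast
    ring

/-- Independence in additive form, so that the bounds below reduce to linear arithmetic of joint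
entropies. -/
theorem entropy_messages_queries (k : Fin K) :
    entropy (Fintype.card F) P.μ (fun ω => ((fun i => P.W i ω), P.queries k ω)) =
      entropy (Fintype.card F) P.μ (fun ω i => P.W i ω) +
        entropy (Fintype.card F) P.μ (P.queries k) := by
  have h := P.independence k
  rw [mutualInfo] at h
  have h2 := condEntropy_eq (q := Fintype.card F) P.μ P.levelMeasurable_messages
    (P.levelMeasurable_queries k)
  change _ - condEntropy _ _ _ (P.queries k) = 0 at h
  linarith

theorem card_compl_singleton (k : Fin K) : (((({k} : Finset (Fin K))ᶜ).card : ℕ) : ℝ) = K - 1 := by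
  have : 0 < K := k.pos
  rw [Finset.card_compl, Finset.card_singleton, Fintype.card_fin, Nat.cast_sub this, Nat.cast_one]

/-- Given the queries, a database only sees its own query: the other queries carry no information
on its answer. -/
theorem condEntropy_answer_query_le (j : Fin K) (n : Fin N) (s : Set (Fin K)) :
    condEntropy (Fintype.card F) P.μ (P.A j n) (fun ω => (P.Q j n ω, P.maskedMessages s ω)) ≤
      condEntropy (Fintype.card F) P.μ (P.A j n)
        (fun ω => (P.queries j ω, P.maskedMessages s ω)) := by
  have hq := one_lt_card (F := F)
  have mA := P.measurable_A j n
  have mQ := P.measurable_Q j n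
  have mQs := P.levelMeasurable_queries j
  have mM := P.levelMeasurable_maskedMessages s
  have mW := P.levelMeasurable_messages
  have mB : LevelMeasurable
      (fun ω => (P.Q j n ω, fun i : {i // i ∈ S.contents n} => P.W i ω)) :=
    LevelMeasurable.prodMk mQ (LevelMeasurable.pi fun i => P.measurable_W i)
  -- the answer is determined by the query and all the messages
  have hdet : condEntropy (Fintype.card F) P.μ (P.A j n)
      (fun ω => (P.Q j n ω, fun i => P.W i ω)) ≤ 0 := by
    rw [← P.answer_deterministic j n]
    refine condEntropy_anti_right hq mA (LevelMeasurable.prodMk mQ mW) mB fun ω ω' h => ?_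
    simp only [Prod.mk.injEq, funext_iff] at h ⊢
    exact ⟨h.1, fun i => h.2 i⟩
  have hind := entropy_add_entropy_le_of_indep hq mW mQs mM mQ (P.entropy_messages_queries j)
    (fun ω ω' h => by
      rw [maskedMessages_eq_iff]
      exact fun i _ => congrFun h i)
    (fun ω ω' h => (P.queries_eq_iff j ω ω').1 h n)
  have hfull := P.entropy_messages_queries j
  have hsub1 := entropy_prodMk_le (μ := P.μ) hq mQs mM
  have hsub2 := entropy_prodMk_le (μ := P.μ) hq mQ mW
  rw [condEntropy_eq P.μ mA (LevelMeasurable.prodMk mQ mW)] at hdet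
  rw [condEntropy_eq P.μ mA (LevelMeasurable.prodMk mQ mM), condEntropy_eq P.μ mA (mQs.prodMk mM)]
  -- submodularity over the pair of the answer with its own query and the masked messages
  have hanti := condEntropy_anti_right (μ := P.μ) hq (LevelMeasurable.prodMk mW mQs)
    (LevelMeasurable.prodMk mA (mQs.prodMk mM)) (LevelMeasurable.prodMk mA (LevelMeasurable.prodMk mQ mM))
    (fun ω ω' h => by
      simp only [Prod.mk.injEq, queries_eq_iff] at h ⊢
      exact ⟨h.1, h.2.1 n, h.2.2⟩)
  -- Given A_n, Q_n and the masked messages, the queries and the messages have nonnegative mutual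
  -- information. As A_n is a function of Q_n and the messages, the last term is at most H(Q_n) +
  -- H(W), and H(W) cancels by independence.
  have hsm := entropy_submodular P.μ hq mQs mW (LevelMeasurable.prodMk mA (LevelMeasurable.prodMk mQ mM))
  have t1 : entropy (Fintype.card F) P.μ (fun ω => ((fun i => P.W i ω), P.queries j ω)) ≤
      entropy (Fintype.card F) P.μ (fun ω => (P.queries j ω, (fun i => P.W i ω),
        P.A j n ω, P.Q j n ω, P.maskedMessages s ω)) :=
    entropy_le_of_determines P.μ hq
      (mQs.prodMk (mW.prodMk (LevelMeasurable.prodMk mA (LevelMeasurable.prodMk mQ mM))))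
      (by simp +contextual)
  have t2 : entropy (Fintype.card F) P.μ (fun ω => ((fun i => P.W i ω),
        P.A j n ω, P.Q j n ω, P.maskedMessages s ω)) ≤
      entropy (Fintype.card F) P.μ (fun ω => (P.A j n ω, P.Q j n ω, fun i => P.W i ω)) :=
    entropy_le_of_determines P.μ hq (LevelMeasurable.prodMk mA (LevelMeasurable.prodMk mQ mW))
      (fun ω ω' h => by
        simp only [Prod.mk.injEq, maskedMessages_eq_iff] at h ⊢
        exact ⟨h.2.2, h.1, h.2.1, fun i _ => congrFun h.2.2 i⟩)
  have t3 : entropy (Fintype.card F) P.μ (fun ω => (P.queries j ω,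
        P.A j n ω, P.Q j n ω, P.maskedMessages s ω)) ≤
      entropy (Fintype.card F) P.μ (fun ω => (P.A j n ω, P.queries j ω, P.maskedMessages s ω)) :=
    entropy_le_of_determines P.μ hq (LevelMeasurable.prodMk mA (mQs.prodMk mM))
      (fun ω ω' h => by
        simp only [Prod.mk.injEq] at h ⊢
        exact ⟨h.2.1, h.1, (P.queries_eq_iff j ω ω').1 h.2.1 n, h.2.2⟩)
  have t4 : entropy (Fintype.card F) P.μ (fun ω => (P.Q j n ω, P.maskedMessages s ω)) ≥
      entropy (Fintype.card F) P.μ (fun ω => (P.maskedMessages s ω, P.Q j n ω)) :=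
    entropy_le_of_determines P.μ hq (LevelMeasurable.prodMk mQ mM)
      (fun ω ω' h => by simp only [Prod.mk.injEq] at h ⊢; exact h.symm)
  linarith

/-- The information on message `i` in the answer of database `n`, when `j` is desired. -/
noncomputable def leakage (j : Fin K) (n : Fin N) (i : Fin K) : ℝ :=
  condEntropy (Fintype.card F) P.μ (P.A j n) (fun ω => (P.Q j n ω, P.maskedMessages {i}ᶜ ω))

theorem levelMeasurable_view (j : Fin K) (n : Fin N) :
    LevelMeasurable (fun ω => (P.Q j n ω, P.A j n ω, fun i => P.W i ω)) :=
  LevelMeasurable.prodMk (P.measurable_Q j n)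
    (LevelMeasurable.prodMk (P.measurable_A j n) P.levelMeasurable_messages)

/-- The one place where privacy enters the converse: it fixes the law of everything a database sees
jointly with the messages. -/
theorem entropy_view {δ : Type*} [Fintype δ] (j j' : Fin K) (n : Fin N)
    (f : P.Query n × P.Answer n × (Fin K → Fin L → F) → δ) :
    entropy (Fintype.card F) P.μ (fun ω => f (P.Q j n ω, P.A j n ω, fun i => P.W i ω)) =
      entropy (Fintype.card F) P.μ (fun ω => f (P.Q j' n ω, P.A j' n ω, fun i => P.W i ω)) := by
  refine entropy_comp_eq_of_law P.μ (P.levelMeasurable_view j n) (P.levelMeasurable_view j' n)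
    (fun ⟨x, a, w⟩ => ?_) f
  convert P.privacy n j j' x a w using 2 <;> (ext ω; simp [funext_iff])

theorem leakage_eq (j j' : Fin K) (n : Fin N) (i : Fin K) :
    P.leakage j n i = P.leakage j' n i := by
  have h (j : Fin K) : LevelMeasurable (fun ω => (P.Q j n ω, P.maskedMessages {i}ᶜ ω)) :=
    LevelMeasurable.prodMk (P.measurable_Q j n) (P.levelMeasurable_maskedMessages _)
  rw [leakage, leakage, condEntropy_eq P.μ (P.measurable_A j n) (h j),
    condEntropy_eq P.μ (P.measurable_A j' n) (h j')]
  congr 1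
  · exact P.entropy_view j j' n fun v => (v.2.1, v.1, mask {i}ᶜ v.2.2)
  · exact P.entropy_view j j' n fun v => (v.1, mask {i}ᶜ v.2.2)

theorem leakage_nonneg (j : Fin K) (n : Fin N) (i : Fin K) : 0 ≤ P.leakage j n i :=
  condEntropy_nonneg one_lt_card (P.measurable_A j n)
    (LevelMeasurable.prodMk (P.measurable_Q j n) (P.levelMeasurable_maskedMessages _))

theorem leakage_le (j : Fin K) (n : Fin N) (i : Fin K) :
    P.leakage j n i ≤ entropy (Fintype.card F) P.μ (P.A j n) :=
  condEntropy_le_entropy one_lt_card (P.measurable_A j n)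
    (LevelMeasurable.prodMk (P.measurable_Q j n) (P.levelMeasurable_maskedMessages _))

theorem condEntropy_answer_of_subset (j : Fin K) (n : Fin N) {s : Set (Fin K)}
    (hs : ∀ i ∈ S.contents n, i ∈ s) :
    condEntropy (Fintype.card F) P.μ (P.A j n)
      (fun ω => (P.Q j n ω, P.maskedMessages s ω)) ≤ 0 := by
  rw [← P.answer_deterministic j n]
  refine condEntropy_anti_right one_lt_card (P.measurable_A j n)
    (LevelMeasurable.prodMk (P.measurable_Q j n) (P.levelMeasurable_maskedMessages _))
    (LevelMeasurable.prodMk (P.measurable_Q j n) (LevelMeasurable.pi fun i => P.measurable_W i))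
    fun ω ω' h => ?_
  simp only [Prod.mk.injEq, funext_iff (f := fun i : {i // i ∈ S.contents n} => P.W i ω),
    maskedMessages_eq_iff] at h ⊢
  exact ⟨h.1, fun i => h.2 i (hs i i.2)⟩

theorem leakage_eq_zero (j : Fin K) (n : Fin N) {i : Fin K} (hi : i ∉ S.contents n) :
    P.leakage j n i = 0 := by
  refine le_antisymm (P.condEntropy_answer_of_subset j n fun k hk => ?_) (P.leakage_nonneg j n i)
  rintro rfl
  exact hi hk

/-- The databases together leak the whole of the desired message. -/
theorem le_sum_leakage (j k : Fin K) : (L : ℝ) ≤ ∑ n, P.leakage j n k := by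
  -- Privacy allows message k to be taken as the desired one, so that its reliability applies.
  simp only [P.leakage_eq j k]
  have hq := one_lt_card (F := F)
  have mQ := P.levelMeasurable_queries k
  have mA := P.levelMeasurable_answers k
  have mV := P.levelMeasurable_maskedMessages {k}ᶜ
  have mW := P.measurable_W k
  have h1 := P.entropy_messages_queries k
  rw [P.entropy_messages] at h1
  have h2 := P.entropy_maskedMessages_le {k}ᶜ
  rw [card_compl_singleton, Finset.coe_compl, Finset.coe_singleton] at h2
  have h3 := entropy_prodMk_le (μ := P.μ) hq mQ mV
  have hrel : condEntropy (Fintype.card F) P.μ (P.W k)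
      (fun ω => (P.answers k ω, P.queries k ω, P.maskedMessages {k}ᶜ ω)) ≤ 0 := by
    rw [← P.reliability k]
    refine condEntropy_anti_right hq mW (mA.prodMk (mQ.prodMk mV)) (mQ.prodMk mA) fun ω ω' h => ?_
    simp only [Prod.mk.injEq] at h
    exact Prod.ext h.2.1 h.1
  rw [condEntropy_eq P.μ mW (mA.prodMk (mQ.prodMk mV))] at hrel
  -- Given the queries and the other messages, W_k still has entropy at least L and is recovered
  -- from the answers; hence the answers have conditional entropy at least L, which `h6` spreads
  -- over the databases.
  have h4 : entropy (Fintype.card F) P.μ (fun ω => ((fun i => P.W i ω), P.queries k ω)) ≤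
      entropy (Fintype.card F) P.μ
        (fun ω => (P.W k ω, P.answers k ω, P.queries k ω, P.maskedMessages {k}ᶜ ω)) :=
    entropy_le_of_determines P.μ hq (LevelMeasurable.prodMk mW (mA.prodMk (mQ.prodMk mV)))
      fun ω ω' h => by
        simp only [Prod.mk.injEq, maskedMessages_eq_iff] at h ⊢
        refine ⟨funext fun i => ?_, h.2.2.1⟩
        by_cases hi : i = k
        · rw [hi]; exact h.1
        · exact h.2.2.2 i hi
  have h5 := condEntropy_eq (q := Fintype.card F) P.μ mA (mQ.prodMk mV)
  have h6 := condEntropy_pi_le (μ := P.μ) hq (P.measurable_A k) (mQ.prodMk mV)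
  have h7 : ∑ n, condEntropy (Fintype.card F) P.μ (P.A k n)
      (fun ω => (P.queries k ω, P.maskedMessages {k}ᶜ ω)) ≤ ∑ n, P.leakage k n k :=
    Finset.sum_le_sum fun n _ => condEntropy_anti_right hq (P.measurable_A k n) (mQ.prodMk mV)
      (LevelMeasurable.prodMk (P.measurable_Q k n) mV) fun ω ω' h => by
        simp only [Prod.mk.injEq, queries_eq_iff] at h ⊢
        exact ⟨h.1 n, h.2⟩
  change condEntropy _ _ (P.answers k) _ ≤ _ at h6
  linarith

/-- The converse for general fully-connected storage: each database serves only two messages. -/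
theorem mul_le_two_mul_download (hS : ∀ n, (S.contents n).card = 2) (j : Fin K) :
    (K : ℝ) * L ≤ 2 * ∑ n, entropy (Fintype.card F) P.μ (P.A j n) := by
  calc (K : ℝ) * L = ∑ _k : Fin K, (L : ℝ) := by simp
    _ ≤ ∑ k, ∑ n, P.leakage j n k := Finset.sum_le_sum fun k _ => P.le_sum_leakage j k
    _ = ∑ n, ∑ k, P.leakage j n k := Finset.sum_comm
    _ = ∑ n, ∑ k ∈ S.contents n, P.leakage j n k :=
        Finset.sum_congr rfl fun n _ => (Finset.sum_subset (Finset.subset_univ _)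
          fun k _ hk => P.leakage_eq_zero j n hk).symm
    _ ≤ ∑ n, ∑ _k ∈ S.contents n, entropy (Fintype.card F) P.μ (P.A j n) :=
        Finset.sum_le_sum fun n _ => Finset.sum_le_sum fun k _ => P.leakage_le j n k
    _ = _ := by simp [hS, Finset.mul_sum]

/-- The download consists of the desired message and of the interference. -/
theorem add_interference_le_download (k : Fin K) :
    (L : ℝ) + condEntropy (Fintype.card F) P.μ (P.answers k)
      (fun ω => (P.queries k ω, P.maskedMessages {k} ω)) ≤
      ∑ n, entropy (Fintype.card F) P.μ (P.A k n) := by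
  have hq := one_lt_card (F := F)
  have mQ := P.levelMeasurable_queries k
  have mA := P.levelMeasurable_answers k
  have mV := P.levelMeasurable_maskedMessages {k}ᶜ
  have mU := P.levelMeasurable_maskedMessages {k}
  have mW := P.measurable_W k
  have h1 := P.entropy_messages_queries k
  rw [P.entropy_messages] at h1
  have h2 := P.entropy_maskedMessages_le {k}ᶜ
  rw [card_compl_singleton, Finset.coe_compl, Finset.coe_singleton] at h2
  have h3 := entropy_prodMk_le (μ := P.μ) hq (mQ.prodMk mU) mV
  have h4 : entropy (Fintype.card F) P.μ (fun ω => ((fun i => P.W i ω), P.queries k ω)) ≤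
      entropy (Fintype.card F) P.μ
        (fun ω => ((P.queries k ω, P.maskedMessages {k} ω), P.maskedMessages {k}ᶜ ω)) :=
    entropy_le_of_determines P.μ hq ((mQ.prodMk mU).prodMk mV) fun ω ω' h => by
        simp only [Prod.mk.injEq, maskedMessages_eq_iff] at h ⊢
        refine ⟨funext fun i => ?_, h.1.1⟩
        by_cases hi : i = k
        · exact h.1.2 i hi
        · exact h.2 i hi
  -- By reliability W_k comes for free with the answers and queries, whereas it adds at least L to
  -- the queries alone: so H(A | Q) ≥ L + H(A | Q, W_k).
  have h5 : entropy (Fintype.card F) P.μ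
      (fun ω => (P.answers k ω, P.queries k ω, P.maskedMessages {k} ω)) ≤
      entropy (Fintype.card F) P.μ (fun ω => (P.W k ω, P.queries k ω, P.answers k ω)) :=
    entropy_le_of_determines P.μ hq (LevelMeasurable.prodMk mW (mQ.prodMk mA)) fun ω ω' h => by
        simp only [Prod.mk.injEq, maskedMessages_eq_iff] at h ⊢
        refine ⟨h.2.2, h.2.1, fun i hi => ?_⟩
        rw [Set.mem_singleton_iff.1 hi]
        exact h.1
  have hrel : condEntropy (Fintype.card F) P.μ (P.W k)
      (fun ω => (P.queries k ω, P.answers k ω)) = 0 := P.reliability k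
  rw [condEntropy_eq P.μ mW (mQ.prodMk mA)] at hrel
  have h6 : entropy (Fintype.card F) P.μ (fun ω => (P.queries k ω, P.answers k ω)) ≤
      entropy (Fintype.card F) P.μ (fun ω => (P.answers k ω, P.queries k ω)) :=
    entropy_le_of_determines P.μ hq (mA.prodMk mQ) fun ω ω' h => by
      simp only [Prod.mk.injEq] at h ⊢
      exact h.symm
  have h7 := condEntropy_eq (q := Fintype.card F) P.μ mA mQ
  have h8 := condEntropy_eq (q := Fintype.card F) P.μ mA (mQ.prodMk mU)
  have h9 := condEntropy_pi_le (μ := P.μ) hq (P.measurable_A k) mQ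
  have h10 : ∑ n, condEntropy (Fintype.card F) P.μ (P.A k n) (P.queries k) ≤
      ∑ n, entropy (Fintype.card F) P.μ (P.A k n) :=
    Finset.sum_le_sum fun n _ => condEntropy_le_entropy hq (P.measurable_A k n) mQ
  change condEntropy _ _ (P.answers k) _ ≤ _ at h9
  linarith

/-- Since i ≠ k, the messages other than i include W_k, and conditioning on fewer of them can only
raise the entropy. -/
theorem leakage_le_of_ne {k i : Fin K} (n : Fin N) (hi : i ≠ k) :
    P.leakage k n i ≤ condEntropy (Fintype.card F) P.μ (P.A k n)
      (fun ω => (P.queries k ω, P.maskedMessages {k} ω)) := by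
  refine (P.condEntropy_answer_query_le k n {i}ᶜ).trans ?_
  refine condEntropy_anti_right one_lt_card (P.measurable_A k n)
    ((P.levelMeasurable_queries k).prodMk (P.levelMeasurable_maskedMessages _))
    ((P.levelMeasurable_queries k).prodMk (P.levelMeasurable_maskedMessages _)) fun ω ω' h => ?_
  simp only [Prod.mk.injEq, maskedMessages_eq_iff] at h ⊢
  refine ⟨h.1, fun l hl => ?_⟩
  rw [Set.mem_singleton_iff.1 hl]
  exact h.2 k hi.symm

theorem leakage_le_interference {k i : Fin K} (n : Fin N) (hi : i ≠ k) :
    P.leakage k n i ≤ condEntropy (Fintype.card F) P.μ (P.answers k)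
      (fun ω => (P.queries k ω, P.maskedMessages {k} ω)) :=
  (P.leakage_le_of_ne n hi).trans <| condEntropy_mono_left one_lt_card (P.measurable_A k n)
    (P.levelMeasurable_answers k)
    ((P.levelMeasurable_queries k).prodMk (P.levelMeasurable_maskedMessages _))
    fun ω ω' h => (P.answers_eq_iff k ω ω').1 h n

/-- Two databases, the first of which does not store `i'`, contribute separately to the
interference. -/
theorem leakage_add_leakage_le {k i i' : Fin K} {n : Fin N} (n' : Fin N) (hi : i ≠ k)
    (hi' : i' ≠ k) (hn : i' ∉ S.contents n) :
    P.leakage k n i + P.leakage k n' i' ≤ condEntropy (Fintype.card F) P.μ (P.answers k)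
      (fun ω => (P.queries k ω, P.maskedMessages {k} ω)) := by
  have hq := one_lt_card (F := F)
  have mQ := P.levelMeasurable_queries k
  have mA := P.measurable_A k n
  have mA' := P.measurable_A k n'
  have mV := P.levelMeasurable_maskedMessages {i'}ᶜ
  have mU := P.levelMeasurable_maskedMessages {k}
  have h0 := condEntropy_mono_left (μ := P.μ) hq (LevelMeasurable.prodMk mA mA')
    (P.levelMeasurable_answers k) (mQ.prodMk mU) fun ω ω' h => by
      rw [answers_eq_iff] at h
      simp only [h n, h n']
  have h1 := condEntropy_prodMk (μ := P.μ) hq mA mA' (mQ.prodMk mU)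
  have h2 := P.leakage_le_of_ne n hi
  have h3 := P.condEntropy_answer_query_le k n' {i'}ᶜ
  have h4 := condEntropy_anti_right (μ := P.μ) hq mA'
    (LevelMeasurable.prodMk mA (mQ.prodMk mV)) (LevelMeasurable.prodMk mA (mQ.prodMk mU))
    fun ω ω' h => by
      simp only [Prod.mk.injEq, maskedMessages_eq_iff] at h ⊢
      refine ⟨h.1, h.2.1, fun l hl => ?_⟩
      rw [Set.mem_singleton_iff.1 hl]
      exact h.2.2 k hi'.symm
  -- Given all messages but i', the answer of n is already known. Conditioning on it in the second
  -- term of the chain rule therefore costs nothing of the leakage of n' about i'.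
  have h5 : condEntropy (Fintype.card F) P.μ (P.A k n)
      (fun ω => (P.queries k ω, P.maskedMessages {i'}ᶜ ω)) ≤ 0 :=
    (condEntropy_anti_right hq mA (mQ.prodMk mV)
      (LevelMeasurable.prodMk (P.measurable_Q k n) mV) fun ω ω' h => by
        simp only [Prod.mk.injEq, queries_eq_iff] at h ⊢
        exact ⟨h.1 n, h.2⟩).trans
    (P.condEntropy_answer_of_subset k n fun l hl hl' => hn (Set.mem_singleton_iff.1 hl' ▸ hl))
  have h6 : entropy (Fintype.card F) P.μ
      (fun ω => (P.A k n' ω, P.queries k ω, P.maskedMessages {i'}ᶜ ω)) ≤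
      entropy (Fintype.card F) P.μ
      (fun ω => (P.A k n' ω, P.A k n ω, P.queries k ω, P.maskedMessages {i'}ᶜ ω)) :=
    entropy_le_of_determines P.μ hq
      (LevelMeasurable.prodMk mA' (LevelMeasurable.prodMk mA (mQ.prodMk mV))) (by simp +contextual)
  rw [condEntropy_eq P.μ mA (mQ.prodMk mV)] at h5
  rw [condEntropy_eq P.μ mA' (mQ.prodMk mV)] at h3
  rw [condEntropy_eq P.μ mA' (LevelMeasurable.prodMk mA (mQ.prodMk mV))] at h4
  rw [leakage, leakage] at *
  linarith

end Scheme

/-! ### Combinatorics of the complete graph. -/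

section Graph

variable {K N : ℕ} {S : StorageSystem K N}

/-- The database joining two messages of a fully-connected system. -/
theorem StorageSystem.IsFullyConnected.exists_edge (hS : S.IsFullyConnected) (hK : 2 ≤ K) :
    ∃ e : Fin K → Fin K → Fin N, (∀ i j, i ≠ j → S.contents (e i j) = {i, j}) ∧
      ∀ n i j, i ≠ j → S.contents n = {i, j} → n = e i j := by
  classical
  -- Two distinct messages supply a database `n₀`, the default value of `e` on the diagonal.
  have h01 : (⟨0, by omega⟩ : Fin K) ≠ ⟨1, by omega⟩ := by simp
  obtain ⟨n₀, -, -⟩ := hS.2 _ _ h01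
  refine ⟨fun i j => if h : i ≠ j then (hS.2 i j h).choose else n₀, fun i j h => ?_,
    fun n i j h hn => ?_⟩
  · simp only [dif_pos h]
    exact (hS.2 i j h).choose_spec.1
  · simp only [dif_pos h]
    exact (hS.2 i j h).choose_spec.2 n hn

theorem StorageSystem.IsFullyConnected.exists_eq_pair_of_mem (hS : S.IsFullyConnected) {n : Fin N}
    {i : Fin K} (hi : i ∈ S.contents n) : ∃ j, i ≠ j ∧ S.contents n = {i, j} := by
  obtain ⟨x, y, hxy, h⟩ := Finset.card_eq_two.1 (hS.1 n)
  rw [h, Finset.mem_insert, Finset.mem_singleton] at hi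
  rcases hi with rfl | rfl
  · exact ⟨y, hxy, h⟩
  · exact ⟨x, hxy.symm, by rw [h, Finset.pair_comm]⟩

theorem StorageSystem.IsFullyConnected.sum_incident (hS : S.IsFullyConnected)
    {e : Fin K → Fin K → Fin N} (he : ∀ i j, i ≠ j → S.contents (e i j) = {i, j})
    (he' : ∀ n i j, i ≠ j → S.contents n = {i, j} → n = e i j) {M : Type*} [AddCommMonoid M]
    (i : Fin K) (g : Fin N → M) (hg : ∀ n, i ∉ S.contents n → g n = 0) :
    ∑ n, g n = ∑ j ∈ Finset.univ.erase i, g (e i j) := by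
  classical
  rw [← Finset.sum_subset (Finset.subset_univ ((Finset.univ.erase i).image (e i))),
    Finset.sum_image]
  · intro j hj j' hj' h
    simp only [Finset.coe_erase, Finset.coe_univ, Set.mem_sdiff, Set.mem_univ,
      Set.mem_singleton_iff, true_and] at hj hj'
    have h1 := he i j (Ne.symm hj)
    rw [h, he i j' (Ne.symm hj')] at h1
    have h2 : j' ∈ ({i, j} : Finset (Fin K)) := h1 ▸ by simp
    simp only [Finset.mem_insert, Finset.mem_singleton] at h2
    exact (h2.resolve_left hj').symm
  · intro n _ hn
    refine hg n fun hi => hn ?_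
    obtain ⟨j, hij, h⟩ := hS.exists_eq_pair_of_mem hi
    exact Finset.mem_image.2 ⟨j, by simp [hij.symm], (he' n i j hij h).symm⟩

theorem StorageSystem.IsFullyConnected.degree (hS : S.IsFullyConnected) (hK : 2 ≤ K) (i : Fin K) :
    (Finset.univ.filter fun n => i ∈ S.contents n).card = K - 1 := by
  obtain ⟨e, he, he'⟩ := hS.exists_edge hK
  rw [Finset.card_filter, hS.sum_incident he he' i _ fun n hn => if_neg hn,
    Finset.sum_congr rfl (g := fun _ => 1) fun j hj => ?_]
  · simp
  · rw [he i j (Finset.ne_of_mem_erase hj).symm]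
    simp

/-- Double counting of the incidences between messages and databases. -/
theorem StorageSystem.IsFullyConnected.two_mul_databases (hS : S.IsFullyConnected) (hK : 2 ≤ K) :
    2 * N = K * (K - 1) := by
  have h1 : ∑ n, (S.contents n).card = 2 * N := by simp [hS.1, mul_comm]
  have h2 : ∑ n, (S.contents n).card =
      ∑ n, ∑ i, if i ∈ S.contents n then 1 else 0 :=
    Finset.sum_congr rfl fun n _ => by simp
  have h3 : ∀ i : Fin K, ∑ n, (if i ∈ S.contents n then 1 else 0) = K - 1 := fun i => by
    rw [← Finset.card_filter, hS.degree hK i]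
  rw [← h1, h2, Finset.sum_comm]
  simp [h3]

/-- Orients the edges along the order of the messages; the scheme for K ≥ 4 treats the two symbols
asymmetrically and needs a transitively oriented triangle. -/
theorem StorageSystem.IsFullyConnected.exists_lt (hS : S.IsFullyConnected) :
    ∃ lo hi : Fin N → Fin K, ∀ n, lo n < hi n ∧ S.contents n = {lo n, hi n} := by
  have : ∀ n, ∃ p : Fin K × Fin K, p.1 < p.2 ∧ S.contents n = {p.1, p.2} := by
    intro n
    obtain ⟨x, y, hxy, h⟩ := Finset.card_eq_two.1 (hS.1 n)
    rcases hxy.lt_or_gt with h' | h'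
    · exact ⟨(x, y), h', h⟩
    · exact ⟨(y, x), h', by rw [h, Finset.pair_comm]⟩
  choose p hp using this
  exact ⟨fun n => (p n).1, fun n => (p n).2, hp⟩

end Graph

/-! ### The sharper converse for two and three messages. -/

namespace Scheme

variable {K N : ℕ} {S : StorageSystem K N} {F : Type} [Field F] [Fintype F] {L : ℕ}

/-- The converse for two and three messages. -/
theorem two_mul_le_download (P : Scheme S F L) (hS : S.IsFullyConnected) (hK : K = 2 ∨ K = 3)
    (k : Fin K) : 2 * (L : ℝ) ≤ ∑ n, entropy (Fintype.card F) P.μ (P.A k n) := by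
  have hmain := P.add_interference_le_download k
  obtain ⟨e, he, he'⟩ := hS.exists_edge (by omega)
  have hsum : ∀ i, ∑ n, P.leakage k n i = ∑ j ∈ Finset.univ.erase i, P.leakage k (e i j) i :=
    fun i => hS.sum_incident he he' i _ fun n hn => P.leakage_eq_zero k n hn
  rcases hK with rfl | rfl
  · obtain ⟨i, hi, h1⟩ : ∃ i : Fin 2, i ≠ k ∧ Finset.univ.erase i = {k} := by
      clear hmain hsum; revert k; decide
    have h2 := P.le_sum_leakage k i
    rw [hsum i, h1, Finset.sum_singleton] at h2
    linarith [P.leakage_le_interference (e i k) hi]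
  · obtain ⟨i, i', hi, hi', hii', h1, h1'⟩ : ∃ i i' : Fin 3, i ≠ k ∧ i' ≠ k ∧ i ≠ i' ∧
        Finset.univ.erase i = {k, i'} ∧ Finset.univ.erase i' = {k, i} := by
      clear hmain hsum; revert k; decide
    have h2 := P.le_sum_leakage k i
    have h2' := P.le_sum_leakage k i'
    rw [hsum i, h1, Finset.sum_pair hi'.symm] at h2
    rw [hsum i', h1', Finset.sum_pair hi.symm] at h2'
    -- The edge {i, i'} serves both bounds, once for its leakage of i' and once for that of i; their
    -- sum is the total leakage of both messages, at least 2 L.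
    have h3 := P.leakage_add_leakage_le (n := e i k) (e i' i) hi hi'
      (by rw [he i k hi]; simp [hii'.symm, hi'])
    have h3' := P.leakage_add_leakage_le (n := e i' k) (e i i') hi' hi
      (by rw [he i' k hi']; simp [hii', hi])
    linarith

end Scheme

/-! ### Schemes attaining the bounds. -/

section Achievability

variable {K N : ℕ} {S : StorageSystem K N} {F : Type} [Field F] [Fintype F] {L : ℕ}

theorem condEntropy_eq_zero_of_determines {Ω : Type*} [MeasurableSpace Ω] {α β : Type*} [Fintype α]
    [Fintype β] {q : ℕ} {μ : Measure Ω} [IsProbabilityMeasure μ] (hq : 1 < q) {X : Ω → α}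
    {Y : Ω → β} (hX : LevelMeasurable X) (hY : LevelMeasurable Y)
    (h : ∀ ω ω', Y ω = Y ω' → X ω = X ω') : condEntropy q μ X Y = 0 := by
  rw [condEntropy_eq μ hX hY, sub_eq_zero]
  refine entropy_congr μ hq (hX.prodMk hY) hY fun ω ω' => ?_
  simp only [Prod.mk.injEq, and_iff_right_iff_imp]
  exact h ω ω'

theorem uniformOn_univ_real {Ω : Type*} [Fintype Ω] [MeasurableSpace Ω] [DiscreteMeasurableSpace Ω]
    (s : Set Ω) : (uniformOn (Set.univ : Set Ω)).real s = s.ncard / Fintype.card Ω := by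
  rw [measureReal_def, uniformOn_univ, ENNReal.toReal_div, ENNReal.toReal_natCast,
    ← measureReal_def, measureReal_def, Measure.count_apply s.toFinite.measurableSet,
    ← s.toFinite.cast_ncard_eq]
  rfl

/-- The scheme in which a uniformly distributed key determines the queries, and a deterministic
function the answers. -/
noncomputable def Scheme.ofKey {Key Query Answer : Type} [Fintype Key] [Nonempty Key]
    [Fintype Query] [Fintype Answer] (query : Fin K → Fin N → Key → Query)
    (answer : Fin N → Query → (Fin K → Fin L → F) → Answer)
    (hanswer : ∀ n x w w', (∀ i ∈ S.contents n, w i = w' i) → answer n x w = answer n x w')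
    (hprivate : ∀ n i j, ∃ e : Key ≃ Key, ∀ s, query j n (e s) = query i n s)
    (hdecode : ∀ k s w w', (∀ n, answer n (query k n s) w = answer n (query k n s) w') →
      w k = w' k) : Scheme S F L :=
  letI : MeasurableSpace (Key × (Fin K → Fin L → F)) := ⊤
  haveI : DiscreteMeasurableSpace (Key × (Fin K → Fin L → F)) := ⟨fun _ => trivial⟩
  haveI : IsProbabilityMeasure (uniformOn (Set.univ : Set (Key × (Fin K → Fin L → F)))) :=
    isProbabilityMeasure_uniformOn Set.finite_univ Set.univ_nonempty
  { Ω := Key × (Fin K → Fin L → F)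
    μ := uniformOn Set.univ
    Query := fun _ => Query
    Answer := fun _ => Answer
    W := fun k ω => ω.2 k
    Q := fun k n ω => query k n ω.1
    A := fun k n ω => answer n (query k n ω.1) ω.2
    measurable_W := fun _ _ => trivial
    measurable_Q := fun _ _ _ => trivial
    measurable_A := fun _ _ _ => trivial
    uniform := fun w => by
      have : {ω : Key × (Fin K → Fin L → F) | ∀ k, ω.2 k = w k} = Set.univ ×ˢ {w} := by
        ext; simp [funext_iff]
      have hk : (Fintype.card Key : ℝ) ≠ 0 := by exact_mod_cast Fintype.card_ne_zero
      rw [uniformOn_univ_real, this, Set.ncard_prod, Set.ncard_univ, Set.ncard_singleton,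
        Nat.card_eq_fintype_card, mul_one, Fintype.card_prod, Nat.cast_mul, div_mul_cancel_left₀ hk]
      simp only [Fintype.card_pi, Finset.prod_const, Finset.card_univ, Fintype.card_fin]
      push_cast
      rw [← pow_mul, mul_comm L K]
    independence := fun k => by
      have mW : LevelMeasurable (fun (ω : Key × (Fin K → Fin L → F)) i => ω.2 i) :=
        fun _ => trivial
      have mQ : LevelMeasurable (fun (ω : Key × (Fin K → Fin L → F)) n => query k n ω.1) :=
        fun _ => trivial
      rw [mutualInfo, condEntropy_eq _ mW mQ, entropy_prodMk_of_indep _ mW mQ]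
      · ring
      · intro w x
        have h1 : (fun (ω : Key × (Fin K → Fin L → F)) i => ω.2 i) ⁻¹' {w} = Set.univ ×ˢ {w} := by
          ext; simp
        have h2 : (fun (ω : Key × (Fin K → Fin L → F)) n => query k n ω.1) ⁻¹' {x} =
            ((fun s n => query k n s) ⁻¹' {x}) ×ˢ Set.univ := by
          ext; simp
        have hk : (Fintype.card Key : ℝ) ≠ 0 := by exact_mod_cast Fintype.card_ne_zero
        have hw : (Fintype.card (Fin K → Fin L → F) : ℝ) ≠ 0 := by
          exact_mod_cast Fintype.card_ne_zero
        rw [h1, h2, Set.prod_inter_prod, Set.univ_inter, Set.inter_univ]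
        simp only [uniformOn_univ_real, Set.ncard_prod, Set.ncard_singleton, Set.ncard_univ,
          Nat.card_eq_fintype_card, Fintype.card_prod, Nat.cast_mul, mul_one]
        field_simp
    answer_deterministic := fun k n => by
      refine condEntropy_eq_zero_of_determines Fintype.one_lt_card (fun _ => trivial)
        (fun _ => trivial) fun ω ω' h => ?_
      simp only [Prod.mk.injEq] at h
      simp only [h.1]
      exact hanswer _ _ _ _ fun i hi => congrFun h.2 ⟨i, hi⟩
    privacy := fun n i j x a w => by
      obtain ⟨e, he⟩ := hprivate n i j
      rw [uniformOn_univ_real, uniformOn_univ_real]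
      congr 2
      -- The bijection of keys that matches the two queries, acting trivially on the messages,
      -- carries one event onto the other.
      rw [← Set.ncard_image_of_injective _ (e.prodCongr (Equiv.refl _)).injective]
      congr 1
      rw [Equiv.image_eq_preimage_symm]
      ext ω
      have h : query i n (e.symm ω.1) = query j n ω.1 := by
        rw [← he, Equiv.apply_symm_apply]
      simp [h]
    reliability := fun k => by
      refine condEntropy_eq_zero_of_determines Fintype.one_lt_card (fun _ => trivial)
        (fun _ => trivial) fun ω ω' h => ?_
      simp only [Prod.mk.injEq, funext_iff] at h
      refine funext fun l => congrFun (hdecode k ω.1 ω.2 ω'.2 fun n => ?_) l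
      rw [h.2 n, h.1 n] }

/-- The symbol at position `p` of a message that consists of `m` symbols from `F ^ b`. -/
def symbolAt {b m : ℕ} (v : Fin (b * m) → F) (p : Fin m) : Fin b → F :=
  fun s => v (finProdFinEquiv (s, p))

/-- Schemes in which every database is asked for a combination of two symbols, one from each of its
messages. The position asked from an undesired message is the same at all databases; the symbols of
the desired message are distributed over the databases by `idx`. -/
theorem exists_scheme {b m : ℕ} [NeZero m] {lo hi : Fin N → Fin K}
    (hlo : ∀ n, S.contents n = {lo n, hi n}) (idx : Fin K → Fin N → Fin m)
    (hidx : ∀ k p, ∃ n, k ∈ S.contents n ∧ idx k n = p) {C : Type} [AddCommGroup C] [Fintype C]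
    (G : Fin N → (Fin b → F) × (Fin b → F) →+ C)
    (hG : ∀ k (f : Fin N → Fin K → Fin b → F), (∀ n n' i, i ≠ k → f n i = f n' i) →
      (∀ n, G n (f n (lo n), f n (hi n)) = 0) → ∀ n, k ∈ S.contents n → f n k = 0)
    (c : Fin N → ℕ) (hc : ∀ n, Nat.card (Set.range (G n)) ≤ Fintype.card F ^ c n) :
    ∃ P : Scheme S F (b * m), ∀ k n, entropy (Fintype.card F) P.μ (P.A k n) ≤ c n := by
  classical
  -- Every database receives a full vector of positions, one per message: a translate of the uniform
  -- key `t`, hence uniform whichever message is desired.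
  let shift : Fin K → Fin N → Fin K → Fin m := fun k n i => if i = k then idx k n else 0
  let answer : Fin N → (Fin K → Fin m) → (Fin K → Fin (b * m) → F) → C := fun n x w =>
    G n (symbolAt (w (lo n)) (x (lo n)), symbolAt (w (hi n)) (x (hi n)))
  let P : Scheme S F (b * m) := Scheme.ofKey (fun k n (t : Fin K → Fin m) => t + shift k n) answer
    (fun n x w w' h => by
      have h1 : w (lo n) = w' (lo n) := h _ (by simp [hlo])
      have h2 : w (hi n) = w' (hi n) := h _ (by simp [hlo])
      simp only [answer, h1, h2])
    (fun n i j => ⟨Equiv.addRight (shift i n - shift j n), fun t => by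
      simp only [Equiv.coe_addRight]; abel⟩)
    (fun k t w w' h => by
      -- By additivity, two message tuples with equal answers have a difference with zero answers,
      -- so decoding reduces to the kernel condition `hG`.
      have key := hG k (fun n i => symbolAt (w i) ((t + shift k n) i) -
          symbolAt (w' i) ((t + shift k n) i))
        (fun n n' i hi => by simp [shift, hi])
        (fun n => by
          have := sub_eq_zero.2 (h n)
          simp only [answer, ← map_sub] at this
          exact this)
      funext l
      obtain ⟨⟨s, p⟩, rfl⟩ := finProdFinEquiv.surjective l
      obtain ⟨n, hn, hp⟩ := hidx k (p - t k)
      have h1 := key n hn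
      have h2 : (t + shift k n) k = p := by simp [shift, hp]
      simp only [h2] at h1
      exact congrFun (sub_eq_zero.1 h1) s)
  refine ⟨P, fun k n => ?_⟩
  have hq : (1 : ℝ) < Fintype.card F := by exact_mod_cast Fintype.one_lt_card (α := F)
  -- The cost is governed by the range of `G n`, which may be smaller than the common codomain `C`.
  let Y : P.Ω → Set.range (G n) := fun ω => ⟨P.A k n ω, Set.mem_range_self _⟩
  have hY : LevelMeasurable Y := fun _ => trivial
  refine (entropy_le_of_determines P.μ Fintype.one_lt_card hY fun ω ω' h =>
    congrArg Subtype.val h).trans ((entropy_le_logb_card P.μ Fintype.one_lt_card hY).trans ?_)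
  have : Nonempty (Set.range (G n)) := ⟨⟨0, 0, map_zero _⟩⟩
  rw [Real.logb_le_iff_le_rpow hq (by exact_mod_cast Fintype.card_pos), Real.rpow_natCast,
    ← Nat.card_eq_fintype_card (α := Set.range (G n))]
  exact_mod_cast hc n

/-- There are as many databases storing a message as it has symbols, so an enumeration of them
assigns one symbol to each; the value at other databases is irrelevant. -/
theorem StorageSystem.IsFullyConnected.exists_idx (hS : S.IsFullyConnected) (hK : 2 ≤ K) :
    ∃ idx : Fin K → Fin N → Fin (K - 1), ∀ k p, ∃ n, k ∈ S.contents n ∧ idx k n = p := by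
  classical
  have : NeZero (K - 1) := ⟨by omega⟩
  let E := fun i => Finset.equivFinOfCardEq (hS.degree hK i)
  refine ⟨fun k n => if h : n ∈ Finset.univ.filter (fun n => k ∈ S.contents n) then E k ⟨n, h⟩
    else 0, fun k p => ?_⟩
  refine ⟨(E k).symm p, ?_, ?_⟩
  · exact (Finset.mem_filter.1 ((E k).symm p).2).2
  · simp only [dif_pos ((E k).symm p).2, Subtype.coe_eta, Equiv.apply_symm_apply]

/-- If a database cannot hide one of its symbols when the other vanishes, then the vanishing of the
answer and of one symbol entails that of the other. -/
theorem symbol_eq_zero {B C : Type*} [Zero B] [Zero C] {lo hi x y : Fin K} {g : B × B → C}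
    (h1 : ∀ u, g (u, 0) = 0 → u = 0) (h2 : ∀ v, g (0, v) = 0 → v = 0) (f : Fin K → B)
    (hxy : x ≠ y) (h : ({lo, hi} : Finset (Fin K)) = {x, y}) (hg : g (f lo, f hi) = 0)
    (hx : f x = 0) : f y = 0 := by
  have hy : y ∈ ({lo, hi} : Finset (Fin K)) := h ▸ by simp
  have hx' : x ∈ ({lo, hi} : Finset (Fin K)) := h ▸ by simp
  simp only [Finset.mem_insert, Finset.mem_singleton] at hy hx'
  rcases hy with rfl | rfl <;> rcases hx' with rfl | rfl
  · exact hx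
  · rw [hx] at hg; exact h1 _ hg
  · rw [hx] at hg; exact h2 _ hg
  · exact hx

/-- For two and three messages: one database is asked for both symbols, the others for sums. -/
theorem exists_scheme_of_le_three (hS : S.IsFullyConnected) (hK : K = 2 ∨ K = 3) :
    ∃ P : Scheme S F (1 * (K - 1)), ∀ k,
      ∑ n, entropy (Fintype.card F) P.μ (P.A k n) ≤ 2 * (K - 1 : ℕ) := by
  have hN := hS.two_mul_databases (by omega)
  have : NeZero (K - 1) := ⟨by omega⟩
  obtain ⟨lo, hi, hlo⟩ := hS.exists_lt
  obtain ⟨idx, hidx⟩ := hS.exists_idx (by omega)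
  obtain ⟨e, he, he'⟩ := hS.exists_edge (by omega)
  let n₀ : Fin N := ⟨0, by rcases hK with rfl | rfl <;> omega⟩
  -- The sums are embedded by `inl` only to share a codomain with the pair returned by `n₀`.
  let G : Fin N → (Fin 1 → F) × (Fin 1 → F) →+ (Fin 1 → F) × (Fin 1 → F) := fun n =>
    if n = n₀ then AddMonoidHom.id _ else
      (AddMonoidHom.inl _ _).comp ((AddMonoidHom.id _).coprod (AddMonoidHom.id _))
  have hG1 : ∀ n u, G n (u, 0) = 0 → u = 0 := by
    intro n u h
    by_cases hn : n = n₀ <;> simpa [G, hn] using h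
  have hG2 : ∀ n v, G n (0, v) = 0 → v = 0 := by
    intro n v h
    by_cases hn : n = n₀ <;> simpa [G, hn] using h
  obtain ⟨P, hP⟩ := exists_scheme (S := S) (fun n => (hlo n).2) idx hidx G
    (fun k f hf h n hn => by
      have hstep : ∀ n x y, x ≠ y → S.contents n = {x, y} → f n x = 0 → f n y = 0 :=
        fun n x y hxy hc => symbol_eq_zero (hG1 n) (hG2 n) (f n) hxy
          ((hlo n).2.symm.trans hc) (h n)
      have h0 : ∀ i ∈ S.contents n₀, f n₀ i = 0 := by
        intro i hi
        have := h n₀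
        simp only [G, if_true, AddMonoidHom.id_apply, Prod.mk_eq_zero] at this
        rw [(hlo n₀).2, Finset.mem_insert, Finset.mem_singleton] at hi
        rcases hi with rfl | rfl
        exacts [this.1, this.2]
      obtain ⟨o, hko, ho⟩ := hS.exists_eq_pair_of_mem hn
      have hok : f n o = 0 := by
        by_cases ho0 : o ∈ S.contents n₀
        · rw [hf n n₀ o hko.symm, h0 o ho0]
        -- One of the two messages at `n₀` is undesired; its known symbol reveals that of o through
        -- the database {a, o}.
        · have : ∃ a ∈ S.contents n₀, a ≠ k := by
            by_contra! hcon
            have := Finset.card_le_card (s := S.contents n₀) (t := {k})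
              fun a ha => Finset.mem_singleton.2 (hcon a ha)
            rw [hS.1 n₀, Finset.card_singleton] at this
            omega
          obtain ⟨a, ha, hak⟩ := this
          have hao : a ≠ o := fun h => ho0 (h ▸ ha)
          rw [hf n (e a o) o hko.symm]
          refine hstep _ a o hao (he a o hao) ?_
          rw [hf _ n₀ a hak, h0 a ha]
      exact hstep n o k hko.symm (by rw [ho, Finset.pair_comm]) hok)
    (fun n => if n = n₀ then 2 else 1)
    (fun n => by
      by_cases hn : n = n₀
      · simp only [hn, if_true]
        refine (Nat.card_le_card_of_injective _ Subtype.val_injective).trans_eq ?_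
        simp [sq]
      · simp only [hn, if_false, G]
        rw [AddMonoidHom.coe_comp]
        have h1 := Nat.card_le_card_of_injective _ (Set.inclusion_injective
          (Set.range_comp_subset_range
          ((AddMonoidHom.id (Fin 1 → F)).coprod (AddMonoidHom.id (Fin 1 → F)))
          (AddMonoidHom.inl (Fin 1 → F) (Fin 1 → F))))
        refine h1.trans ((Finite.card_range_le _).trans_eq ?_)
        simp)
  refine ⟨P, fun k => (Finset.sum_le_sum fun n _ => hP k n).trans_eq ?_⟩
  norm_cast
  have : ∑ n : Fin N, (if n = n₀ then 2 else 1) = ∑ n : Fin N, ((if n = n₀ then 1 else 0) + 1) :=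
    Finset.sum_congr rfl fun n _ => by split_ifs <;> rfl
  rw [this, Finset.sum_add_distrib]
  simp only [Finset.sum_ite_eq', Finset.mem_univ, if_true, Finset.sum_const, Finset.card_univ,
    Fintype.card_fin, smul_eq_mul, mul_one]
  -- The download N + 1 equals 2 (K - 1) exactly when (K - 2)(K - 3) = 0.
  rcases hK with rfl | rfl <;> omega

/-- For four and more messages: every database is asked for a sum of a symbol and of an
endomorphism `T` of the other, such that `T` and `1 + T` are injective. -/
theorem exists_scheme_of_four_le (hS : S.IsFullyConnected) (hK : 4 ≤ K) :
    ∃ P : Scheme S F (2 * (K - 1)), ∀ k,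
      ∑ n, entropy (Fintype.card F) P.μ (P.A k n) ≤ K * (K - 1 : ℕ) := by
  have hN := hS.two_mul_databases (by omega)
  have : NeZero (K - 1) := ⟨by omega⟩
  obtain ⟨lo, hi, hlo⟩ := hS.exists_lt
  obtain ⟨idx, hidx⟩ := hS.exists_idx (by omega)
  obtain ⟨e, he, he'⟩ := hS.exists_edge (by omega)
  -- `G (u, v)` is u + T v with T = [[0, 1], [1, 1]]. T and 1 + T have determinants -1 and 1, so
  -- both are invertible over every field; over the field of two elements no scalar T would do,
  -- whence symbols in F².
  let G : (Fin 2 → F) × (Fin 2 → F) →+ (Fin 2 → F) :=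
    AddMonoidHom.mk' (fun p => ![p.1 0 + p.2 1, p.1 1 + (p.2 0 + p.2 1)]) fun p p' => by
      funext s
      fin_cases s <;> simp <;> ring
  have hGiff : ∀ u v, G (u, v) = 0 ↔ u 0 + v 1 = 0 ∧ u 1 + (v 0 + v 1) = 0 := by
    intro u v
    simp [G, funext_iff]
  have hG1 : ∀ u, G (u, 0) = 0 → u = 0 := by
    intro u h
    rw [hGiff] at h
    funext s
    fin_cases s
    · simpa using h.1
    · simpa using h.2
  have hG2 : ∀ v, G (0, v) = 0 → v = 0 := by
    intro v h
    rw [hGiff] at h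
    have h1 : v 1 = 0 := by simpa using h.1
    have h2 : v 0 = 0 := by simpa [h1] using h.2
    funext s
    fin_cases s
    exacts [h2, h1]
  -- The first two equations give T (v - w) = 0, so v = w; the third becomes (1 + T) w = 0.
  have hG3 : ∀ u v w, G (u, v) = 0 → G (u, w) = 0 → G (v, w) = 0 → w = 0 := by
    intro u v w h1 h2 h3
    rw [hGiff] at h1 h2 h3
    have e1 : v 1 = w 1 := by linear_combination h1.1 - h2.1
    have e0 : v 0 = w 0 := by linear_combination h1.2 - h2.2 - e1
    have d1 : w 1 = 0 := by linear_combination h3.2 - h3.1 + e0 - e1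
    have d0 : w 0 = 0 := by linear_combination h3.1 - e0 - d1
    funext s
    fin_cases s
    exacts [d0, d1]
  obtain ⟨P, hP⟩ := exists_scheme (S := S) (fun n => (hlo n).2) idx hidx (fun _ => G)
    (fun k f hf h n hn => by
      have hstep : ∀ n x y, x ≠ y → S.contents n = {x, y} → f n x = 0 → f n y = 0 :=
        fun n x y hxy hc => symbol_eq_zero hG1 hG2 (f n) hxy ((hlo n).2.symm.trans hc) (h n)
      have hedge : ∀ i j, i < j → i ≠ k → j ≠ k → G (f n i, f n j) = 0 := by
        intro i j hij hik hjk
        have h1 := h (e i j)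
        have h2 := (hlo (e i j)).2.symm.trans (he i j hij.ne)
        have h3 := (hlo (e i j)).1
        have h4 : i ∈ ({lo (e i j), hi (e i j)} : Finset (Fin K)) := h2 ▸ by simp
        have h5 : j ∈ ({lo (e i j), hi (e i j)} : Finset (Fin K)) := h2 ▸ by simp
        simp only [Finset.mem_insert, Finset.mem_singleton] at h4 h5
        have h6 : lo (e i j) = i ∧ hi (e i j) = j := by
          rcases h4 with h4 | h4 <;> rcases h5 with h5 | h5
          · exact absurd (h4.trans h5.symm) hij.ne
          · exact ⟨h4.symm, h5.symm⟩
          · rw [← h4, ← h5] at h3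
            exact absurd h3 hij.not_gt
          · exact absurd (h4.trans h5.symm) hij.ne
        rw [h6.1, h6.2, hf _ n i hik, hf _ n j hjk] at h1
        exact h1
      -- Here K ≥ 4 is essential: three messages remain besides k.
      obtain ⟨a, b, c, hab, hbc, hak, hbk, hck⟩ :
          ∃ a b c : Fin K, a < b ∧ b < c ∧ a ≠ k ∧ b ≠ k ∧ c ≠ k := by
        by_cases hk0 : (k : ℕ) = 0
        · exact ⟨⟨1, by omega⟩, ⟨2, by omega⟩, ⟨3, by omega⟩, by simp, by simp,
            by simp [Fin.ext_iff]; omega, by simp [Fin.ext_iff]; omega, by simp [Fin.ext_iff]; omega⟩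
        by_cases hk1 : (k : ℕ) = 1
        · exact ⟨⟨0, by omega⟩, ⟨2, by omega⟩, ⟨3, by omega⟩, by simp, by simp,
            by simp [Fin.ext_iff]; omega, by simp [Fin.ext_iff]; omega, by simp [Fin.ext_iff]; omega⟩
        by_cases hk2 : (k : ℕ) = 2
        · exact ⟨⟨0, by omega⟩, ⟨1, by omega⟩, ⟨3, by omega⟩, by simp, by simp,
            by simp [Fin.ext_iff]; omega, by simp [Fin.ext_iff]; omega, by simp [Fin.ext_iff]; omega⟩
        · exact ⟨⟨0, by omega⟩, ⟨1, by omega⟩, ⟨2, by omega⟩, by simp, by simp,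
            by simp [Fin.ext_iff]; omega, by simp [Fin.ext_iff]; omega, by simp [Fin.ext_iff]; omega⟩
      have hc0 : f n c = 0 := hG3 _ _ _ (hedge a b hab hak hbk)
        (hedge a c (hab.trans hbc) hak hck) (hedge b c hbc hbk hck)
      -- From c, each undesired o is reached through the database {c, o}, and then k through {o, k}.
      obtain ⟨o, hko, ho⟩ := hS.exists_eq_pair_of_mem hn
      have hok : f n o = 0 := by
        rcases eq_or_ne c o with rfl | hco
        · exact hc0
        · rw [hf n (e c o) o hko.symm]
          refine hstep _ c o hco (he c o hco) ?_
          rw [hf _ n c hck, hc0]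
      exact hstep n o k hko.symm (by rw [ho, Finset.pair_comm]) hok)
    (fun _ => 2)
    (fun n => (Nat.card_le_card_of_injective _ Subtype.val_injective).trans_eq (by simp))
  refine ⟨P, fun k => (Finset.sum_le_sum fun n _ => hP k n).trans_eq ?_⟩
  norm_cast
  simp only [Finset.sum_const, Finset.card_univ, Fintype.card_fin, smul_eq_mul]
  omega

end Achievability

/-- The capacity is determined by a lower bound on the download of every scheme, and by a scheme
that attains it. -/
theorem isCapacity_of_download {K N : ℕ} {S : StorageSystem K N} {F : Type} [Field F] [Fintype F]
    {c : ℝ} (hc : 0 < c) (hconverse : ∀ (L : ℕ) (P : Scheme S F L) (k : Fin K),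
      (L : ℝ) ≤ c * ∑ n, entropy (Fintype.card F) P.μ (P.A k n))
    (L : ℕ) (hL : 0 < L) (P : Scheme S F L) (k : Fin K)
    (hP : c * ∑ n, entropy (Fintype.card F) P.μ (P.A k n) ≤ L) : IsCapacity S F c := by
  have hpos : ∀ (L : ℕ) (_ : 0 < L) (P : Scheme S F L) (k : Fin K),
      0 < ∑ n, entropy (Fintype.card F) P.μ (P.A k n) := by
    intro L hL P k
    have h : (0 : ℝ) < L := by exact_mod_cast hL
    exact pos_of_mul_pos_right (h.trans_le (hconverse L P k)) hc.le
  refine ⟨?_, fun b hb => ?_⟩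
  · rintro r ⟨L, hL, P, k, rfl⟩
    rw [Scheme.rate, div_le_iff₀ (hpos L hL P k)]
    exact hconverse L P k
  · refine le_trans ?_ (hb ⟨L, hL, P, k, rfl⟩)
    rw [Scheme.rate, le_div_iff₀ (hpos L hL P k)]
    exact hP

end PIR

/-! ### The capacity. -/

theorem theorem3 {K N : ℕ} (S : PIR.StorageSystem K N) (hS : S.IsFullyConnected)
    (F : Type) [Field F] [Fintype F] :
    (K = 2 ∨ K = 3 → PIR.IsCapacity S F (1 / 2)) ∧
      (4 ≤ K → PIR.IsCapacity S F (2 / (K : ℝ))) := by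
  constructor
  · intro hK
    obtain ⟨P, hP⟩ := PIR.exists_scheme_of_le_three (F := F) hS hK
    have k : Fin K := ⟨0, by omega⟩
    refine PIR.isCapacity_of_download (by norm_num) (fun L P k => ?_) _ (by omega) P k ?_
    · linarith [P.two_mul_le_download hS hK k]
    · have := hP k
      rw [Nat.cast_mul, Nat.cast_one]
      linarith
  · intro hK
    have hK' : (0 : ℝ) < K := by exact_mod_cast (by omega : 0 < K)
    obtain ⟨P, hP⟩ := PIR.exists_scheme_of_four_le (F := F) hS hK
    have k : Fin K := ⟨0, by omega⟩
    refine PIR.isCapacity_of_download (by positivity) (fun L P k => ?_) _ (by omega) P k ?_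
    · have := P.mul_le_two_mul_download hS.1 k
      rw [div_mul_eq_mul_div, le_div_iff₀ hK']
      linarith
    · rw [div_mul_eq_mul_div, div_le_iff₀ hK', Nat.cast_mul, Nat.cast_two]
      linarith [hP k]
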